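/- Let $\mathcal H_A \neq \{0\}$, $\mathcal H_B$ and $\mathcal H_E$ be finite-dimensional complex Hilbert spaces. A (Heisenberg-picture) quantum channel is a completely positive unital linear map between the algebras $\mathcal B(\mathcal H)$ of bounded operators. Let $T_B : \mathcal B(\mathcal H_B) \to \mathcal B(\mathcal H_A)$ be a quantum channel with Stinespring dilation $(\mathcal H_E, V)$, i.e. $V : \mathcal H_A \to \mathcal H_B \otimes \mathcal H_E$ is linear with $T_B(b) = V^*(b \otimes \mathbb 1_E)V$ for all $b \in \mathcal B(\mathcal H_B)$ (so that $V$ is an isometry). Let $T_E : \mathcal B(\mathcal H_E) \to \mathcal B(\mathcal H_A)$, $T_E(e) := V^*(\mathbb 1_B \otimes e)V$, be the complementary channel. For a quantum state $\sigma$ on $\mathcal H_E$ ($\sigma \ge 0$, $\operatorname{tr}\sigma = 1$), let $S_\sigma : \mathcal B(\mathcal H_E) \to \mathcal B(\mathcal H_A)$, $S_\sigma(e) := \operatorname{tr}(\sigma e)\,\mathbb 1_A$, be the corresponding completely depolarizing channel. For a linear map $\Phi$, let $\|\Phi\|_{cb} := \sup_{\nu \in \mathbb N} \|\mathrm{id}_\nu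 \otimes \Phi\|$, where $\mathrm{id}_\nu$ is the identity on the complex $\nu\times\nu$ matrices and $\|\cdot\|$ is the operator norm induced by the operator norms of $\mathcal B(\mathbb C^\nu \otimes \mathcal H)$. Below, the infima run over all quantum channels $D : \mathcal B(\mathcal H_A) \to \mathcal B(\mathcal H_B)$ (decoding channels). Then, for every quantum state $\sigma$ on $\mathcal H_E$, $$\tfrac14 \inf_D \|T_B D - \mathrm{id}_A\|_{cb}^2 \;\le\; \|T_E - S_\sigma\|_{cb},$$ and there is a quantum state $\sigma$ on $\mathcal H_E$ such that $$\|T_E - S_\sigma\|_{cb} \;\le\; 2 \inf_D \|T_B D - \mathrm{id}_A\|_{cb}^{1/2}.$$ In particular, for this $\sigma$ both estimates hold. The constants do not depend on any dimension. -/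

import Mathlib

open scoped TensorProduct ENNReal

/-- Finite-dimensional complex inner product spaces are complete, that is, Hilbert spaces. -/
instance (priority := low) finiteDimensionalHilbertComplete (H : Type*) [NormedAddCommGroup H]
    [InnerProductSpace ℂ H] [FiniteDimensional ℂ H] : CompleteSpace H :=
  FiniteDimensional.complete ℂ H

noncomputable section

/-- The norm of complete boundedness (cb-norm) of a linear map `Φ` between C⋆-algebras: the supremum
over all `n` of the operator norms of the amplifications `id_n ⊗ Φ`, which apply `Φ` to every entry
of an `n × n` matrix. The matrices over a C⋆-algebra carry their C⋆-norm. -/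
def cbNorm {R S : Type*} [NonUnitalCStarAlgebra R] [PartialOrder R] [StarOrderedRing R]
    [NonUnitalCStarAlgebra S] [PartialOrder S] [StarOrderedRing S] (Φ : R →ₗ[ℂ] S) : ℝ≥0∞ :=
  ⨆ (n : ℕ) (X : CStarMatrix (Fin n) (Fin n) R) (_ : ‖X‖ ≤ 1), ENNReal.ofReal ‖X.map Φ‖

/-- A quantum channel, in the Heisenberg picture, with input space `HA` and output space `HB`:
a completely positive unital linear map `B(HB) → B(HA)`. -/
structure QuantumChannel (HB HA : Type*) [NormedAddCommGroup HB] [InnerProductSpace ℂ HB]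
    [FiniteDimensional ℂ HB] [NormedAddCommGroup HA] [InnerProductSpace ℂ HA]
    [FiniteDimensional ℂ HA] extends
    CompletelyPositiveMap (HB →L[ℂ] HB) (HA →L[ℂ] HA) where
  map_one' : toFun 1 = 1

section

variable {HA HB HE : Type*}
  [NormedAddCommGroup HA] [InnerProductSpace ℂ HA] [FiniteDimensional ℂ HA]
  [NormedAddCommGroup HB] [InnerProductSpace ℂ HB] [FiniteDimensional ℂ HB]
  [NormedAddCommGroup HE] [InnerProductSpace ℂ HE] [FiniteDimensional ℂ HE]

/-- `(HE, V)` is a Stinespring representation of `T`: `T b = V† (b ⊗ 1) V` for all `b ∈ B(HB)`.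
As `T` is unital, `V` is then an isometry. -/
def IsStinespringRepresentation (T : QuantumChannel HB HA) (V : HA →L[ℂ] HB ⊗[ℂ] HE) : Prop :=
  ∀ b : HB →L[ℂ] HB, T.toLinearMap b =
    ContinuousLinearMap.adjoint V ∘L TensorProduct.mapL b (ContinuousLinearMap.id ℂ HE) ∘L V

/-- The complementary channel `e ↦ V† (1 ⊗ e) V`, from `B(HE)` to `B(HA)`. -/
def complementaryChannel (V : HA →L[ℂ] HB ⊗[ℂ] HE) : (HE →L[ℂ] HE) →ₗ[ℂ] (HA →L[ℂ] HA) where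
  toFun e :=
    ContinuousLinearMap.adjoint V ∘L TensorProduct.mapL (ContinuousLinearMap.id ℂ HB) e ∘L V
  map_add' e f := by
    ext x
    simp [TensorProduct.mapL_add_right]
  map_smul' c e := by
    ext x
    simp [TensorProduct.mapL_smul_right]

/-- A quantum state (normalized density operator): `σ ≥ 0` and `tr σ = 1`. -/
def IsQuantumState (σ : HE →L[ℂ] HE) : Prop :=
  0 ≤ σ ∧ LinearMap.trace ℂ HE σ.toLinearMap = 1

variable (HA) in
/-- The completely depolarizing map `e ↦ tr (σ e) 1`, from `B(HE)` to `B(HA)`. -/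
def depolarizingChannel (σ : HE →L[ℂ] HE) : (HE →L[ℂ] HE) →ₗ[ℂ] (HA →L[ℂ] HA) where
  toFun e := LinearMap.trace ℂ HE (σ * e).toLinearMap • (1 : HA →L[ℂ] HA)
  map_add' e f := by
    simp [mul_add, add_smul]
  map_smul' c e := by
    simp [mul_smul]

/-- `inf_D ‖T D - id‖_cb`, the infimum over all decoding channels `D : B(HA) → B(HB)`. -/
def decodingError (T : QuantumChannel HB HA) : ℝ≥0∞ :=
  ⨅ D : QuantumChannel HA HB, cbNorm (T.toLinearMap ∘ₗ D.toLinearMap - LinearMap.id)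

end

end

/-!
The proof works with Kraus operators throughout. A Stinespring isometry `V x = ∑ₖ Aₖ x ⊗ eₖ` is the
same as a family `A` with `∑ₖ Aₖ† Aₖ = 1`, the channel is `e ↦ ∑ₖ Aₖ† e Aₖ`, and expanding `V` along
a basis of the other tensor factor gives the Kraus family of the complementary channel
(`complementaryFamily`).

The heart of the matter is that the cb-distance of two channels controls, without dimension factors,
the distance of suitable Stinespring isometries, and conversely. The easy half is
`cbNorm_krausMap_sub_le`: Kraus families at distance `c` give channels at cb-distance at most `2 c`.
The other half is `exists_contraction_pairing_ge`: if `‖T_A - T_B‖_cb ≤ δ`, then there is a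
contraction `w` between the dilation spaces with
`Re ∑ᵢⱼ wᵢⱼ ⟪Bⱼ x, Aᵢ x⟫ ≥ (1 - δ / 2) ‖x‖²` for *all* `x`. For a fixed mixture of vectors this is
the Fuchs–van de Graaf inequality, obtained from the Powers–Størmer inequality
(`exists_trace_sub_sq_le`) and polar decomposition; a separation argument and compactness make `w`
independent of the mixture. Mixtures of `n` vectors of `H` are vectors of `Hⁿ`, which is where the
amplifications in the cb-norm enter.

For the first inequality, this is applied to the complementary channel and the depolarizing channel.
The contraction becomes a contractive Kraus family `HB → HA`, whose isometric extension defines a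
decoder `D`; the Kraus family of `T_B D` is then at distance at most `√δ` from a family of multiples
of `1`, which represents the identity (`decodingError_le_of_cbNorm_le`).

For the second inequality, it is applied to `T_B D`, in the Kraus form given by Choi's theorem, and
the identity. Now `w` is a vector, which after normalization purifies a state `σ`, and passing to
complementary families shows that the complementary channel is close to the depolarizing channel of
`σ` (`exists_isQuantumState_cbNorm_le`). A state that works for all `D` at once exists because the
cb-norm is lower semicontinuous and the set of states is compact.
-/

noncomputable section

/-! ### Matrices of operators as operators on `Hⁿ` -/

section BlockOperators

variable {n H : Type*} [Fintype n]
  [NormedAddCommGroup H] [InnerProductSpace ℂ H] [FiniteDimensional ℂ H]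

/-- The operator on `Hⁿ` given by an `n × n` matrix of operators on `H`. -/
def blockOperator (X : CStarMatrix n n (H →L[ℂ] H)) :
    PiLp 2 (fun _ : n => H) →L[ℂ] PiLp 2 (fun _ : n => H) :=
  LinearMap.toContinuousLinearMap
    { toFun := fun x => WithLp.toLp 2 fun i => ∑ j, X i j (x j)
      map_add' := fun x y => by
        ext i
        simp [Finset.sum_add_distrib]
      map_smul' := fun c x => by
        ext i
        simp [Finset.smul_sum] }

theorem blockOperator_apply (X : CStarMatrix n n (H →L[ℂ] H)) (x : PiLp 2 (fun _ : n => H))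
    (i : n) : blockOperator X x i = ∑ j, X i j (x j) := rfl

theorem inner_blockOperator (X : CStarMatrix n n (H →L[ℂ] H)) (x y : PiLp 2 (fun _ : n => H)) :
    inner ℂ x (blockOperator X y) = ∑ i, ∑ j, inner ℂ (x i) (X i j (y j)) := by
  simp [PiLp.inner_apply, blockOperator_apply, inner_sum]

variable [DecidableEq n]

variable (n H) in
/-- `blockOperator` as a homomorphism of C⋆-algebras. -/
def blockHom : CStarMatrix n n (H →L[ℂ] H) →⋆ₐ[ℂ]
    (PiLp 2 (fun _ : n => H) →L[ℂ] PiLp 2 (fun _ : n => H)) where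
  toFun := blockOperator
  map_one' := by
    ext x i
    rw [blockOperator_apply, Finset.sum_eq_single i] <;>
      simp +contextual [eq_comm]
  map_mul' X Y := by
    ext x i
    simp only [blockOperator_apply, CStarMatrix.mul_apply, mul_apply_eq_comp,
      sum_apply, map_sum]
    exact Finset.sum_comm
  map_zero' := by
    ext x i
    simp [blockOperator_apply]
  map_add' X Y := by
    ext x i
    simp [blockOperator_apply, Finset.sum_add_distrib]
  commutes' c := by
    ext x i
    rw [blockOperator_apply, Finset.sum_eq_single i] <;>
      simp +contextual [CStarMatrix.algebraMap_apply, Algebra.algebraMap_eq_smul_one, eq_comm]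
  map_star' X := by
    rw [ContinuousLinearMap.star_eq_adjoint, ContinuousLinearMap.eq_adjoint_iff]
    intro x y
    simp only [blockOperator_apply,
      PiLp.inner_apply, CStarMatrix.star_apply, ContinuousLinearMap.star_eq_adjoint, sum_inner,
      inner_sum, ContinuousLinearMap.adjoint_inner_left]
    exact Finset.sum_comm

theorem blockOperator_single (X : CStarMatrix n n (H →L[ℂ] H)) (i j : n) (v : H) :
    blockOperator X (PiLp.single 2 j v) i = X i j v := by
  rw [blockOperator_apply, Finset.sum_eq_single j]
  · simp
  · intro k _ hk
    simp [hk]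
  · simp

theorem blockHom_bijective : Function.Bijective (blockHom n H) := by
  constructor
  · intro X Y h
    refine CStarMatrix.ext fun i j => ?_
    ext v
    rw [← blockOperator_single X, ← blockOperator_single Y]
    exact congrArg (fun P => P (PiLp.single 2 j v) i) h
  · intro P
    refine ⟨CStarMatrix.ofMatrix fun i j => (PiLp.proj 2 (fun _ : n => H) i : _ →L[ℂ] H) ∘L P ∘L
      LinearMap.toContinuousLinearMap
        { toFun := fun v => PiLp.single 2 j v
          map_add' := fun _ _ => PiLp.single_add 2 j
          map_smul' := fun c v => by
            ext k
            by_cases hk : k = j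
            · subst hk
              simp
            · simp [hk] }, ?_⟩
    ext x i
    have hx : x = ∑ j, PiLp.single 2 j (x j) := by
      ext k
      simp [Finset.sum_apply, Pi.single_apply]
    change blockOperator _ x i = _
    rw [blockOperator_apply]
    conv_rhs => rw [hx, map_sum, WithLp.ofLp_sum, Finset.sum_apply]
    rfl

/-- The C⋆-norm of matrices is the operator norm on `Hⁿ`, since `blockHom` is an injective
homomorphism of C⋆-algebras. -/
theorem norm_blockOperator (X : CStarMatrix n n (H →L[ℂ] H)) : ‖blockOperator X‖ = ‖X‖ :=
  NonUnitalStarAlgHom.norm_map (blockHom n H) blockHom_bijective.1 X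

theorem norm_inner_blockOperator_le (X : CStarMatrix n n (H →L[ℂ] H))
    (x y : PiLp 2 (fun _ : n => H)) :
    ‖(inner ℂ x (blockOperator X y) : ℂ)‖ ≤ ‖X‖ * ‖x‖ * ‖y‖ := by
  refine (norm_inner_le_norm _ _).trans ?_
  have := (blockOperator X).le_opNorm y
  rw [norm_blockOperator] at this
  nlinarith [norm_nonneg x]

theorem cstarMatrix_nonneg_of_isPositive {X : CStarMatrix n n (H →L[ℂ] H)}
    (h : (blockOperator X).IsPositive) : 0 ≤ X := by
  have h1 : 0 ≤ blockHom n H X := (ContinuousLinearMap.nonneg_iff_isPositive _).2 h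
  have := map_nonneg (StarAlgEquiv.ofBijective (blockHom n H) blockHom_bijective).symm h1
  rwa [← StarAlgEquiv.ofBijective_apply (hf := blockHom_bijective),
    StarAlgEquiv.symm_apply_apply] at this

theorem isPositive_blockOperator {X : CStarMatrix n n (H →L[ℂ] H)} (h : 0 ≤ X) :
    (blockOperator X).IsPositive :=
  (ContinuousLinearMap.nonneg_iff_isPositive _).1 (map_nonneg (blockHom n H) h)

end BlockOperators

/-! ### Kraus maps and their cb-norms -/

section KrausMaps

variable {ι n H₁ H₂ : Type*} [Fintype ι] [Fintype n]
  [NormedAddCommGroup H₁] [InnerProductSpace ℂ H₁] [FiniteDimensional ℂ H₁]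
  [NormedAddCommGroup H₂] [InnerProductSpace ℂ H₂]

variable (n) in
/-- The amplification `Hⁿ → Kⁿ` of an operator `H → K`. -/
def amplify (A : H₁ →L[ℂ] H₂) : PiLp 2 (fun _ : n => H₁) →L[ℂ] PiLp 2 (fun _ : n => H₂) :=
  LinearMap.toContinuousLinearMap
    { toFun := fun x => WithLp.toLp 2 fun i => A (x i)
      map_add' := fun x y => by
        ext i
        simp
      map_smul' := fun c x => by
        ext i
        simp }

theorem amplify_apply (A : H₁ →L[ℂ] H₂) (x : PiLp 2 (fun _ : n => H₁)) (i : n) :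
    amplify n A x i = A (x i) := rfl

/-- The family `A` of operators is bounded by `c`: the column operator `x ↦ (Aᵢ x)ᵢ` has norm at
most `c`. -/
def IsColumnBound (A : ι → H₁ →L[ℂ] H₂) (c : ℝ) : Prop :=
  0 ≤ c ∧ ∀ x, ∑ i, ‖A i x‖ ^ 2 ≤ c ^ 2 * ‖x‖ ^ 2

theorem IsColumnBound.sum_norm_amplify_sq_le {A : ι → H₁ →L[ℂ] H₂} {c : ℝ} (h : IsColumnBound A c)
    (x : PiLp 2 (fun _ : n => H₁)) : ∑ i, ‖amplify n (A i) x‖ ^ 2 ≤ (c * ‖x‖) ^ 2 := by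
  simp only [PiLp.norm_sq_eq_of_L2, amplify_apply, mul_pow]
  rw [Finset.sum_comm, Finset.mul_sum]
  exact Finset.sum_le_sum fun m _ => h.2 _

variable [FiniteDimensional ℂ H₂]

/-- The map `e ↦ ∑ᵢ Aᵢ† e Bᵢ` from `B(H₂)` to `B(H₁)`. For `A = B` these are the completely positive
maps in Kraus form, with Kraus operators `Aᵢ`. -/
def krausMap (A B : ι → H₁ →L[ℂ] H₂) : (H₂ →L[ℂ] H₂) →ₗ[ℂ] (H₁ →L[ℂ] H₁) where
  toFun e := ∑ i, ContinuousLinearMap.adjoint (A i) ∘L e ∘L B i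
  map_add' e f := by simp [Finset.sum_add_distrib]
  map_smul' c e := by simp [Finset.smul_sum]

theorem krausMap_apply (A B : ι → H₁ →L[ℂ] H₂) (e : H₂ →L[ℂ] H₂) :
    krausMap A B e = ∑ i, ContinuousLinearMap.adjoint (A i) ∘L e ∘L B i := rfl

theorem inner_krausMap (A B : ι → H₁ →L[ℂ] H₂) (e : H₂ →L[ℂ] H₂) (x y : H₁) :
    inner ℂ x (krausMap A B e y) = ∑ i, inner ℂ (A i x) (e (B i y)) := by
  simp [krausMap_apply, sum_apply, ContinuousLinearMap.adjoint_inner_right]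

theorem inner_blockOperator_map_krausMap (A B : ι → H₁ →L[ℂ] H₂)
    (X : CStarMatrix n n (H₂ →L[ℂ] H₂)) (x y : PiLp 2 (fun _ : n => H₁)) :
    inner ℂ x (blockOperator (X.map (krausMap A B)) y) =
      ∑ i, inner ℂ (amplify n (A i) x) (blockOperator X (amplify n (B i) y)) := by
  simp only [inner_blockOperator, CStarMatrix.map_apply, inner_krausMap, amplify_apply]
  rw [Finset.sum_comm]
  refine (Finset.sum_congr rfl fun j _ => Finset.sum_comm).trans ?_
  rw [Finset.sum_comm]
  exact Finset.sum_congr rfl fun i _ => Finset.sum_comm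

/-- The Cauchy–Schwarz bound behind all cb-norm estimates: `e ↦ ∑ᵢ Aᵢ† e Bᵢ` is `A† (e ⊗ 1) B` for
the column operators `A` and `B`, and amplifying it does not change the norms of the columns. -/
theorem norm_map_krausMap_le {A B : ι → H₁ →L[ℂ] H₂} {a b : ℝ} (hA : IsColumnBound A a)
    (hB : IsColumnBound B b) [DecidableEq n] (X : CStarMatrix n n (H₂ →L[ℂ] H₂)) :
    ‖X.map (krausMap A B)‖ ≤ a * b * ‖X‖ := by
  rw [← norm_blockOperator]
  have hab := mul_nonneg hA.1 hB.1
  refine ContinuousLinearMap.opNorm_le_of_re_inner_le (by positivity) fun x y hx hy => ?_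
  rw [← inner_conj_symm, RCLike.conj_re, inner_blockOperator_map_krausMap]
  refine (RCLike.re_le_norm _).trans ((norm_sum_le _ _).trans ?_)
  have hA' := hA.sum_norm_amplify_sq_le y
  have hB' := hB.sum_norm_amplify_sq_le x
  rw [hx] at hB'
  rw [hy] at hA'
  have hcs : ∑ i, ‖amplify n (A i) y‖ * ‖amplify n (B i) x‖ ≤ a * b := by
    refine (Real.sum_mul_le_sqrt_mul_sqrt _ _ _).trans ?_
    exact mul_le_mul (Real.sqrt_le_iff.2 ⟨hA.1, by rwa [mul_one] at hA'⟩)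
      (Real.sqrt_le_iff.2 ⟨hB.1, by rwa [mul_one] at hB'⟩) (Real.sqrt_nonneg _) hA.1
  refine le_trans (Finset.sum_le_sum fun i _ => ?_)
    ((Finset.mul_sum _ _ _).symm.le.trans ((mul_le_mul_of_nonneg_left hcs (norm_nonneg X)).trans
      (mul_comm _ _).le))
  rw [← mul_assoc]
  exact norm_inner_blockOperator_le X _ _

theorem cbNorm_le {Φ : (H₂ →L[ℂ] H₂) →ₗ[ℂ] (H₁ →L[ℂ] H₁)} {c : ℝ} (hc : 0 ≤ c)
    (h : ∀ (n : ℕ) (X : CStarMatrix (Fin n) (Fin n) (H₂ →L[ℂ] H₂)), ‖X.map Φ‖ ≤ c * ‖X‖) :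
    cbNorm Φ ≤ ENNReal.ofReal c :=
  iSup_le fun n => iSup_le fun X => iSup_le fun hX =>
    ENNReal.ofReal_le_ofReal ((h n X).trans (mul_le_of_le_one_right hc hX))

theorem norm_map_le_of_cbNorm_le {Φ : (H₂ →L[ℂ] H₂) →ₗ[ℂ] (H₁ →L[ℂ] H₁)} {c : ℝ} (hc : 0 ≤ c)
    (h : cbNorm Φ ≤ ENNReal.ofReal c) {n : ℕ} (X : CStarMatrix (Fin n) (Fin n) (H₂ →L[ℂ] H₂))
    (hX : ‖X‖ ≤ 1) : ‖X.map Φ‖ ≤ c := by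
  refine (ENNReal.ofReal_le_ofReal_iff hc).1 (le_trans ?_ h)
  exact le_iSup_of_le n (le_iSup_of_le X (le_iSup_of_le hX le_rfl))

/-- Kraus maps with nearby Kraus operators are close in cb-norm. -/
theorem cbNorm_krausMap_sub_le {A B : ι → H₁ →L[ℂ] H₂} {c : ℝ} (hA : IsColumnBound A 1)
    (hB : IsColumnBound B 1) (hAB : IsColumnBound (fun i => A i - B i) c) :
    cbNorm (krausMap A A - krausMap B B) ≤ ENNReal.ofReal (2 * c) := by
  refine cbNorm_le (by linarith [hAB.1]) fun n X => ?_
  have : X.map (krausMap A A - krausMap B B) =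
      X.map (krausMap (fun i => A i - B i) A) + X.map (krausMap B fun i => A i - B i) := by
    refine CStarMatrix.ext fun i j => ?_
    simp only [CStarMatrix.map_apply, LinearMap.sub_apply, CStarMatrix.add_apply, krausMap_apply,
      ← Finset.sum_sub_distrib, ← Finset.sum_add_distrib]
    refine Finset.sum_congr rfl fun k _ => ?_
    ext x
    simp
  rw [this]
  refine (norm_add_le _ _).trans ?_
  linarith [norm_map_krausMap_le hAB hA X, norm_map_krausMap_le hB hAB X]

theorem cbNorm_krausMap_sub_le_two {κ : Type*} [Fintype κ] {A : ι → H₁ →L[ℂ] H₂}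
    {B : κ → H₁ →L[ℂ] H₂} (hA : IsColumnBound A 1) (hB : IsColumnBound B 1) :
    cbNorm (krausMap A A - krausMap B B) ≤ 2 := by
  rw [← ENNReal.ofReal_ofNat]
  refine cbNorm_le (by norm_num) fun n X => ?_
  have : X.map (krausMap A A - krausMap B B) =
      X.map (krausMap A A) - X.map (krausMap B B) :=
    CStarMatrix.ext fun i j => rfl
  rw [this]
  refine (norm_sub_le _ _).trans ?_
  linarith [norm_map_krausMap_le hA hA X, norm_map_krausMap_le hB hB X]

theorem krausMap_map_nonneg [DecidableEq n] (A : ι → H₁ →L[ℂ] H₂)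
    {X : CStarMatrix n n (H₂ →L[ℂ] H₂)} (hX : 0 ≤ X) : 0 ≤ X.map (krausMap A A) := by
  apply cstarMatrix_nonneg_of_isPositive
  have : blockOperator (X.map (krausMap A A)) =
      ∑ i, ContinuousLinearMap.adjoint (amplify n (A i)) ∘L blockOperator X ∘L amplify n (A i) := by
    refine ContinuousLinearMap.ext fun y => ext_inner_left ℂ fun x => ?_
    simp [inner_blockOperator_map_krausMap, sum_apply, inner_sum,
      ContinuousLinearMap.adjoint_inner_right]
  rw [this]
  exact ContinuousLinearMap.isPositive_sum _ fun i _ => (isPositive_blockOperator hX).adjoint_conj _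

/-- An isometric Kraus family defines a quantum channel. -/
def krausChannel (A : ι → H₁ →L[ℂ] H₂)
    (h : ∑ i, ContinuousLinearMap.adjoint (A i) ∘L A i = 1) : QuantumChannel H₂ H₁ where
  __ := krausMap A A
  map_cstarMatrix_nonneg' _ _ hM := krausMap_map_nonneg A hM
  map_one' := by
    change krausMap A A 1 = 1
    rw [krausMap_apply, ← h]
    rfl

end KrausMaps

/-! ### The Powers–Størmer inequality -/

section PowersStormer

variable {F G : Type*} [NormedAddCommGroup F] [InnerProductSpace ℂ F] [FiniteDimensional ℂ F]
  [NormedAddCommGroup G] [InnerProductSpace ℂ G] [FiniteDimensional ℂ G]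

open ContinuousLinearMap in
/-- Polar decomposition of a possibly non-square operator: `S` is the square root of `α α†`, and the
contraction `Z` is the adjoint of the partial isometry in `α = S Z†`. -/
theorem exists_positive_sqrt_comp_adjoint (α : F →L[ℂ] G) :
    ∃ (S : G →L[ℂ] G) (Z : G →L[ℂ] F), S.IsPositive ∧ S ∘L S = α ∘L adjoint α ∧ ‖Z‖ ≤ 1 ∧
      α ∘L Z = S := by
  have hpos : 0 ≤ α ∘L adjoint α :=
    (nonneg_iff_isPositive _).2 (isPositive_self_comp_adjoint α)
  set S := CFC.sqrt (α ∘L adjoint α) with hS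
  have hSp : S.IsPositive := (nonneg_iff_isPositive _).1 (CFC.sqrt_nonneg _)
  have hSS : S ∘L S = α ∘L adjoint α := CFC.sqrt_mul_sqrt_self _ hpos
  have hSa : adjoint S = S := hSp.isSelfAdjoint.adjoint_eq
  have hnorm : ∀ v, ‖adjoint α v‖ = ‖S v‖ := fun v => by
    have h1 : (inner ℂ (S v) (S v) : ℂ) = inner ℂ (adjoint α v) (adjoint α v) := by
      rw [adjoint_inner_left, ← comp_apply α, ← hSS]
      exact hSp.isSymmetric v (S v)
    rw [inner_self_eq_norm_sq_to_K, inner_self_eq_norm_sq_to_K] at h1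
    have h2 : ‖S v‖ ^ 2 = ‖adjoint α v‖ ^ 2 := by exact_mod_cast h1
    exact ((sq_eq_sq₀ (norm_nonneg _) (norm_nonneg _)).1 h2).symm
  let K : Submodule ℂ G := LinearMap.range S.toLinearMap
  obtain ⟨g, hg⟩ := LinearMap.exists_rightInverse_of_surjective S.toLinearMap.rangeRestrict
    (LinearMap.range_rangeRestrict _)
  have hg' : ∀ w : K, S (g w) = w := fun w => congrArg Subtype.val (LinearMap.congr_fun hg w)
  let Z : G →L[ℂ] F := adjoint α ∘L LinearMap.toContinuousLinearMap g ∘L K.orthogonalProjectionOnto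
  refine ⟨S, Z, hSp, hSS, ?_, ?_⟩
  · refine opNorm_le_bound _ zero_le_one fun w => ?_
    change ‖adjoint α (g (K.orthogonalProjectionOnto w))‖ ≤ _
    rw [hnorm, hg', one_mul]
    exact K.norm_orthogonalProjectionOnto_apply_le w
  · ext w
    change α (adjoint α (g (K.orthogonalProjectionOnto w))) = S w
    rw [← comp_apply α, ← hSS, comp_apply, hg']
    refine ext_inner_left ℂ fun v => ?_
    rw [← adjoint_inner_left, ← adjoint_inner_left, hSa]
    exact Submodule.inner_orthogonalProjectionOnto_eq_of_mem_left (⟨S v, v, rfl⟩ : K) w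

open ContinuousLinearMap in
/-- The Powers–Størmer inequality `‖S₁ - S₂‖₂² ≤ ‖S₁² - S₂²‖₁`, with the trace norm on the right
replaced by the value of the trace at a contraction `P`, the sign of `S₁ - S₂`. -/
theorem exists_trace_sub_sq_le {S₁ S₂ : G →L[ℂ] G} (h₁ : S₁.IsPositive) (h₂ : S₂.IsPositive) :
    ∃ P : G →L[ℂ] G, ‖P‖ ≤ 1 ∧
      (LinearMap.trace ℂ G ((S₁ - S₂) ∘L (S₁ - S₂)).toLinearMap).re ≤
        (LinearMap.trace ℂ G (P ∘L (S₁ ∘L S₁ - S₂ ∘L S₂)).toLinearMap).re := by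
  have hD : (S₁ - S₂).toLinearMap.IsSymmetric :=
    h₁.isSymmetric.sub h₂.isSymmetric
  let u := hD.eigenvectorBasis rfl
  let l := hD.eigenvalues rfl
  have hu : ∀ m, (S₁ - S₂) (u m) = (l m : ℂ) • u m := hD.apply_eigenvectorBasis rfl
  let s : _ → ℝ := fun m => SignType.sign (l m)
  have hs1 : ∀ m, |s m| ≤ 1 := fun m => by
    rcases lt_trichotomy (l m) 0 with h | h | h <;> simp [s, h]
  let P : G →L[ℂ] G := ∑ m, (s m : ℂ) • InnerProductSpace.rankOne ℂ (u m) (u m)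
  have hP : ∀ m x, inner ℂ (u m) (P x) = (s m : ℂ) * inner ℂ (u m) x := fun m x => by
    simp only [P, sum_apply, inner_sum, smul_apply, inner_smul_right,
      InnerProductSpace.rankOne_apply]
    rw [Finset.sum_eq_single m]
    · simp
    · intro k _ hk
      rw [u.inner_eq_ite, if_neg hk.symm]
      simp
    · simp
  refine ⟨P, ?_, ?_⟩
  · refine opNorm_le_bound _ zero_le_one fun x => ?_
    rw [one_mul, ← sq_le_sq₀ (norm_nonneg _) (norm_nonneg _), ← u.sum_sq_norm_inner_right (P x),
      ← u.sum_sq_norm_inner_right x]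
    refine Finset.sum_le_sum fun m _ => ?_
    rw [hP, norm_mul, Complex.norm_real, Real.norm_eq_abs, mul_pow]
    exact mul_le_of_le_one_left (sq_nonneg _) (pow_le_one₀ (abs_nonneg _) (hs1 m))
  · rw [LinearMap.trace_eq_sum_inner _ u, LinearMap.trace_eq_sum_inner _ u, Complex.re_sum,
      Complex.re_sum]
    refine Finset.sum_le_sum fun m _ => ?_
    have hnn₁ : 0 ≤ (inner ℂ (u m) (S₁ (u m)) : ℂ).re := h₁.re_inner_nonneg_right _
    have hnn₂ : 0 ≤ (inner ℂ (u m) (S₂ (u m)) : ℂ).re := h₂.re_inner_nonneg_right _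
    have hsub : (inner ℂ (u m) (S₁ (u m)) : ℂ).re - (inner ℂ (u m) (S₂ (u m)) : ℂ).re = l m := by
      rw [← Complex.sub_re, ← inner_sub_right, ← sub_apply, hu, inner_smul_right]
      simp
    have hL : (inner ℂ (u m) (((S₁ - S₂) ∘L (S₁ - S₂)).toLinearMap (u m)) : ℂ).re = l m ^ 2 := by
      change (inner ℂ (u m) ((S₁ - S₂) ((S₁ - S₂) (u m))) : ℂ).re = _
      rw [hu, map_smul, hu]
      simp [sq]
    have hR : (inner ℂ (u m) ((P ∘L (S₁ ∘L S₁ - S₂ ∘L S₂)).toLinearMap (u m)) : ℂ).re =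
        s m * (l m * ((inner ℂ (u m) (S₁ (u m)) : ℂ).re + (inner ℂ (u m) (S₂ (u m)) : ℂ).re)) := by
      change (inner ℂ (u m) (P (S₁ (S₁ (u m)) - S₂ (S₂ (u m)))) : ℂ).re = _
      rw [hP, Complex.re_ofReal_mul]
      congr 1
      -- `2 (S₁² - S₂²) = (S₁ - S₂) (S₁ + S₂) + (S₁ + S₂) (S₁ - S₂)`, evaluated at an eigenvector
      have e1 : S₁ (u m) = (l m : ℂ) • u m + S₂ (u m) := by
        rw [← hu m, sub_apply, sub_add_cancel]
      have e2 : S₁ (S₁ (u m)) - S₂ (S₂ (u m)) = (l m : ℂ) • S₁ (u m) + (S₁ - S₂) (S₂ (u m)) := by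
        have e3 := congrArg S₁ e1
        rw [map_add, map_smul] at e3
        rw [e3, sub_apply]
        abel
      have e4 : (inner ℂ (u m) ((S₁ - S₂) (S₂ (u m))) : ℂ) = l m * inner ℂ (u m) (S₂ (u m)) := by
        rw [← Complex.conj_ofReal, ← inner_smul_left, ← hu]
        exact (hD (u m) (S₂ (u m))).symm
      rw [e2, inner_add_right, inner_smul_right, e4, ← mul_add, Complex.re_ofReal_mul,
        Complex.add_re]
    rw [hL, hR]
    have habs : s m * l m = |l m| := by
      rcases lt_trichotomy (l m) 0 with h | h | h <;> simp [s, h, abs_of_neg, abs_of_pos]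
    rw [← mul_assoc, habs, ← sq_abs, sq]
    refine mul_le_mul_of_nonneg_left ?_ (abs_nonneg _)
    rw [abs_le]
    constructor <;> linarith

end PowersStormer

/-! ### Continuity of the Kraus form -/

section KrausPairing

variable {I J H₁ H₂ : Type*} [Fintype I] [Fintype J] [DecidableEq J]
  [NormedAddCommGroup H₁] [InnerProductSpace ℂ H₁]
  [NormedAddCommGroup H₂] [InnerProductSpace ℂ H₂]

/-- The isometry condition `∑ᵢ Aᵢ† Aᵢ = 1` on a family of Kraus operators, in terms of norms. -/
def IsKrausIsometry (A : I → H₁ →L[ℂ] H₂) : Prop :=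
  ∀ x, ∑ i, ‖A i x‖ ^ 2 = ‖x‖ ^ 2

theorem IsKrausIsometry.isColumnBound {A : I → H₁ →L[ℂ] H₂} (h : IsKrausIsometry A) :
    IsColumnBound A 1 :=
  ⟨zero_le_one, fun x => by rw [h x]; simp⟩

/-- The pairing `∑ⱼ ⟪Bⱼ x, ∑ᵢ wᵢⱼ Aᵢ x⟫`, with `wᵢⱼ` the matrix of `w`. In terms of the Stinespring
isometries `A x = ∑ᵢ Aᵢ x ⊗ eᵢ` and `B x = ∑ⱼ Bⱼ x ⊗ eⱼ` it is `⟪B x, (1 ⊗ wᵗ) A x⟫`. -/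
def krausPairing (A : I → H₁ →L[ℂ] H₂) (B : J → H₁ →L[ℂ] H₂)
    (w : EuclideanSpace ℂ J →L[ℂ] EuclideanSpace ℂ I) (x : H₁) : ℂ :=
  ∑ j, inner ℂ (B j x) (∑ i, w (EuclideanSpace.single j 1) i • A i x)

theorem continuous_krausPairing (A : I → H₁ →L[ℂ] H₂) (B : J → H₁ →L[ℂ] H₂) (x : H₁) :
    Continuous fun w => (krausPairing A B w x).re := by
  unfold krausPairing
  fun_prop

theorem krausPairing_add (A : I → H₁ →L[ℂ] H₂) (B : J → H₁ →L[ℂ] H₂)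
    (w z : EuclideanSpace ℂ J →L[ℂ] EuclideanSpace ℂ I) (x : H₁) :
    krausPairing A B (w + z) x = krausPairing A B w x + krausPairing A B z x := by
  simp [krausPairing, add_smul, Finset.sum_add_distrib]

theorem krausPairing_smul (A : I → H₁ →L[ℂ] H₂) (B : J → H₁ →L[ℂ] H₂) (c : ℝ)
    (w : EuclideanSpace ℂ J →L[ℂ] EuclideanSpace ℂ I) (x : H₁) :
    krausPairing A B (c • w) x = c * krausPairing A B w x := by
  simp only [krausPairing, Finset.mul_sum, smul_apply]
  refine Finset.sum_congr rfl fun j _ => ?_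
  rw [← inner_smul_right, Finset.smul_sum]
  refine congrArg _ (Finset.sum_congr rfl fun i _ => ?_)
  rw [smul_smul]
  rfl

theorem krausPairing_smul_vector (A : I → H₁ →L[ℂ] H₂) (B : J → H₁ →L[ℂ] H₂) (c : ℝ)
    (w : EuclideanSpace ℂ J →L[ℂ] EuclideanSpace ℂ I) (x : H₁) :
    krausPairing A B w ((c : ℂ) • x) = (c ^ 2 : ℝ) * krausPairing A B w x := by
  simp only [krausPairing, Finset.mul_sum]
  refine Finset.sum_congr rfl fun j _ => ?_
  simp only [map_smul, inner_smul_left, smul_comm _ (c : ℂ), ← Finset.smul_sum, inner_smul_right,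
    Complex.conj_ofReal]
  push_cast
  ring

end KrausPairing

section Continuity

variable {I J G H₁ H₂ : Type*} [Fintype I] [Fintype J] [DecidableEq I] [DecidableEq J]
  [NormedAddCommGroup G] [InnerProductSpace ℂ G]
  [NormedAddCommGroup H₁] [InnerProductSpace ℂ H₁] [FiniteDimensional ℂ H₁]
  [NormedAddCommGroup H₂] [InnerProductSpace ℂ H₂] [FiniteDimensional ℂ H₂]

/-- The operator `c ↦ ∑ᵢ cᵢ vᵢ` from `ℂᴵ`. -/
def synthesis (v : I → G) :
    EuclideanSpace ℂ I →L[ℂ] G :=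
  LinearMap.toContinuousLinearMap
    { toFun := fun c => ∑ i, c i • v i
      map_add' := fun c d => by simp [add_smul, Finset.sum_add_distrib]
      map_smul' := fun a c => by simp [mul_smul, Finset.smul_sum] }

theorem synthesis_single (v : I → G)
    (i : I) : synthesis v (EuclideanSpace.single i 1) = v i := by
  change ∑ k, (EuclideanSpace.single i (1 : ℂ)).ofLp k • v k = v i
  rw [Finset.sum_eq_single i]
  · simp
  · intro k _ hk
    simp [hk]
  · simp

open ContinuousLinearMap in
theorem trace_comp_synthesis_adjoint [FiniteDimensional ℂ G] (v : I → G)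
    (P : EuclideanSpace ℂ I →L[ℂ] G) :
    LinearMap.trace ℂ G (P ∘L adjoint (synthesis v)).toLinearMap =
      ∑ i, inner ℂ (v i) (P (EuclideanSpace.single i 1)) := by
  rw [toLinearMap_comp, LinearMap.trace_comp_comm', ← toLinearMap_comp,
    LinearMap.trace_eq_sum_inner _ (EuclideanSpace.basisFun I ℂ)]
  refine Finset.sum_congr rfl fun i _ => ?_
  rw [EuclideanSpace.basisFun_apply]
  change inner ℂ _ (adjoint (synthesis v) (P _)) = _
  rw [adjoint_inner_right, synthesis_single]

open ContinuousLinearMap in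
/-- The Fuchs–van de Graaf inequality for the operators `ρ = ∑ᵢ |vᵢ⟩⟨vᵢ|` and
`τ = ∑ⱼ |uⱼ⟩⟨uⱼ|`, with Uhlmann's description of the fidelity as an overlap of purifications: for
some contractions `w` and `P`, `tr ρ + tr τ - 2 Re ∑ᵢⱼ wᵢⱼ ⟪uⱼ, vᵢ⟫ ≤ Re tr P (ρ - τ)`. -/
theorem exists_contraction_le_trace [FiniteDimensional ℂ G] (v : I → G) (u : J → G) :
    ∃ (w : EuclideanSpace ℂ J →L[ℂ] EuclideanSpace ℂ I) (P : G →L[ℂ] G), ‖w‖ ≤ 1 ∧ ‖P‖ ≤ 1 ∧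
      ∑ i, ‖v i‖ ^ 2 + ∑ j, ‖u j‖ ^ 2 -
        2 * (∑ j, inner ℂ (u j) (∑ i, w (EuclideanSpace.single j 1) i • v i) : ℂ).re ≤
      (∑ i, inner ℂ (v i) (P (v i)) - ∑ j, inner ℂ (u j) (P (u j)) : ℂ).re := by
  obtain ⟨S₁, Z₁, hS₁, hSS₁, hZ₁, hvZ⟩ := exists_positive_sqrt_comp_adjoint (synthesis v)
  obtain ⟨S₂, Z₂, hS₂, hSS₂, hZ₂, huZ⟩ := exists_positive_sqrt_comp_adjoint (synthesis u)
  obtain ⟨P, hP, hle⟩ := exists_trace_sub_sq_le hS₁ hS₂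
  have hw : ‖Z₁ ∘L adjoint Z₂‖ ≤ 1 := by
    refine (opNorm_comp_le _ _).trans ?_
    rw [LinearIsometryEquiv.norm_map]
    exact mul_le_one₀ hZ₁ (norm_nonneg _) hZ₂
  refine ⟨Z₁ ∘L adjoint Z₂, P, hw, hP, ?_⟩
  -- this choice of `w` turns the overlap into `tr √ρ √τ`, as it occurs in Powers–Størmer
  have h12 : S₁ ∘L S₂ = (synthesis v ∘L Z₁ ∘L adjoint Z₂) ∘L adjoint (synthesis u) := by
    have : S₂ = adjoint Z₂ ∘L adjoint (synthesis u) := by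
      rw [← adjoint_comp, huZ, hS₂.isSelfAdjoint.adjoint_eq]
    rw [this, ← hvZ]
    rfl
  have htr : ∀ (v' : G), (inner ℂ v' v' : ℂ).re = ‖v'‖ ^ 2 := fun v' => by
    rw [inner_self_eq_norm_sq_to_K]
    norm_cast
  have t12 := trace_comp_synthesis_adjoint u (synthesis v ∘L Z₁ ∘L adjoint Z₂)
  rw [← h12] at t12
  have t1 := trace_comp_synthesis_adjoint v (synthesis v)
  have t2 := trace_comp_synthesis_adjoint u (synthesis u)
  have p1 := trace_comp_synthesis_adjoint v (P ∘L synthesis v)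
  have p2 := trace_comp_synthesis_adjoint u (P ∘L synthesis u)
  rw [comp_assoc, ← hSS₁] at p1
  rw [comp_assoc, ← hSS₂] at p2
  rw [← hSS₁] at t1
  rw [← hSS₂] at t2
  have t21 : LinearMap.trace ℂ G (S₂ ∘L S₁).toLinearMap =
      LinearMap.trace ℂ G (S₁ ∘L S₂).toLinearMap := by
    rw [toLinearMap_comp, toLinearMap_comp, LinearMap.trace_comp_comm']
  have hl : (S₁ - S₂) ∘L (S₁ - S₂) = S₁ ∘L S₁ - S₁ ∘L S₂ - S₂ ∘L S₁ + S₂ ∘L S₂ := by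
    rw [sub_comp, comp_sub, comp_sub]
    abel
  rw [hl, comp_sub] at hle
  simp only [toLinearMap_add, toLinearMap_sub, map_add, map_sub, t21, t12, t1, t2, p1, p2] at hle
  simp only [comp_apply, synthesis_single, Complex.sub_re, Complex.add_re, Complex.re_sum,
    htr] at hle
  have hsyn : ∀ c, synthesis v c = ∑ i, c i • v i := fun _ => rfl
  simp only [hsyn] at hle
  simp only [Complex.sub_re, Complex.re_sum, comp_apply]
  linarith

/-- If two channels are close in cb-norm, then for each vector `(ξₘ)` of `H₁ⁿ` there is a
contraction `w` for which the purified output vectors overlap. The bound on the `n`-th amplification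
is what is used for families of `n` vectors. -/
theorem exists_contraction_pairing_ge_of_family {A : I → H₁ →L[ℂ] H₂} {B : J → H₁ →L[ℂ] H₂}
    (hA : IsKrausIsometry A) (hB : IsKrausIsometry B) {δ : ℝ} (hδ : 0 ≤ δ)
    (h : cbNorm (krausMap A A - krausMap B B) ≤ ENNReal.ofReal δ) {n : ℕ} (ξ : Fin n → H₁) :
    ∃ w : EuclideanSpace ℂ J →L[ℂ] EuclideanSpace ℂ I, ‖w‖ ≤ 1 ∧
      (1 - δ / 2) * ∑ m, ‖ξ m‖ ^ 2 ≤ ∑ m, (krausPairing A B w (ξ m)).re := by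
  let x : PiLp 2 (fun _ : Fin n => H₁) := WithLp.toLp 2 ξ
  have hx : ‖x‖ ^ 2 = ∑ m, ‖ξ m‖ ^ 2 := PiLp.norm_sq_eq_of_L2 _ _
  obtain ⟨w, P, hw, hP, hle⟩ := exists_contraction_le_trace (fun i => amplify (Fin n) (A i) x)
    (fun j => amplify (Fin n) (B j) x)
  refine ⟨w, hw, ?_⟩
  obtain ⟨X, rfl⟩ := blockHom_bijective.2 P
  have hX : ‖X‖ ≤ 1 := (norm_blockOperator X).symm.le.trans hP
  have hA1 : ∑ i, ‖amplify (Fin n) (A i) x‖ ^ 2 = ‖x‖ ^ 2 := by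
    rw [hx]
    simp only [PiLp.norm_sq_eq_of_L2, amplify_apply]
    rw [Finset.sum_comm]
    exact Finset.sum_congr rfl fun m _ => hA _
  have hB1 : ∑ i, ‖amplify (Fin n) (B i) x‖ ^ 2 = ‖x‖ ^ 2 := by
    rw [hx]
    simp only [PiLp.norm_sq_eq_of_L2, amplify_apply]
    rw [Finset.sum_comm]
    exact Finset.sum_congr rfl fun m _ => hB _
  have hpair : (∑ j, inner ℂ (amplify (Fin n) (B j) x)
      (∑ i, w (EuclideanSpace.single j 1) i • amplify (Fin n) (A i) x) : ℂ) =
      ∑ m, krausPairing A B w (ξ m) := by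
    simp only [krausPairing, PiLp.inner_apply]
    rw [Finset.sum_comm]
    refine Finset.sum_congr rfl fun m _ => Finset.sum_congr rfl fun j _ => ?_
    rw [WithLp.ofLp_sum, Finset.sum_apply]
    rfl
  have e : (∑ i, inner ℂ (amplify (Fin n) (A i) x)
        (blockHom (Fin n) H₂ X (amplify (Fin n) (A i) x)) -
      ∑ j, inner ℂ (amplify (Fin n) (B j) x)
        (blockHom (Fin n) H₂ X (amplify (Fin n) (B j) x)) : ℂ) =
      inner ℂ x (blockOperator (X.map (krausMap A A - krausMap B B)) x) := by
    have hs : X.map (krausMap A A - krausMap B B) =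
        X.map (krausMap A A) - X.map (krausMap B B) := CStarMatrix.ext fun i j => rfl
    have hs' : blockOperator (X.map (krausMap A A) - X.map (krausMap B B)) =
        blockOperator (X.map (krausMap A A)) - blockOperator (X.map (krausMap B B)) :=
      map_sub (blockHom (Fin n) H₁) _ _
    rw [hs, hs', sub_apply, inner_sub_right, inner_blockOperator_map_krausMap,
      inner_blockOperator_map_krausMap]
    rfl
  have hup : (inner ℂ x (blockOperator (X.map (krausMap A A - krausMap B B)) x) : ℂ).re ≤
      δ * ‖x‖ ^ 2 := by
    refine (Complex.re_le_norm _).trans ((norm_inner_blockOperator_le _ _ _).trans ?_)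
    rw [mul_assoc, ← sq]
    exact mul_le_mul_of_nonneg_right (norm_map_le_of_cbNorm_le hδ h X hX) (sq_nonneg _)
  rw [hA1, hB1, hpair, Complex.re_sum, e] at hle
  rw [← hx]
  linarith

/-- The contraction can be chosen uniformly over finitely many vectors. The possible tuples of
pairings form a compact convex set; if it missed the orthant in question, a separating functional
would have nonnegative coefficients `pₘ`, contradicting the bound for the family `√pₘ xₘ`. -/
theorem exists_contraction_pairing_ge_finite {A : I → H₁ →L[ℂ] H₂} {B : J → H₁ →L[ℂ] H₂}
    (hA : IsKrausIsometry A) (hB : IsKrausIsometry B) {δ : ℝ} (hδ : 0 ≤ δ)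
    (h : cbNorm (krausMap A A - krausMap B B) ≤ ENNReal.ofReal δ) {n : ℕ} (x : Fin n → H₁) :
    ∃ w : EuclideanSpace ℂ J →L[ℂ] EuclideanSpace ℂ I, ‖w‖ ≤ 1 ∧
      ∀ m, (1 - δ / 2) * ‖x m‖ ^ 2 ≤ (krausPairing A B w (x m)).re := by
  let g : (EuclideanSpace ℂ J →L[ℂ] EuclideanSpace ℂ I) →ₗ[ℝ] (Fin n → ℝ) :=
    { toFun := fun w m => (krausPairing A B w (x m)).re
      map_add' := fun w z => by
        ext m
        simp [krausPairing_add]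
      map_smul' := fun c w => by
        ext m
        simp [krausPairing_smul] }
  have hgc : Continuous g := continuous_pi fun m => continuous_krausPairing A B (x m)
  let b : Fin n → ℝ := fun m => (1 - δ / 2) * ‖x m‖ ^ 2
  have hproper : ProperSpace (EuclideanSpace ℂ J →L[ℂ] EuclideanSpace ℂ I) :=
    FiniteDimensional.proper ℂ _
  by_contra! hne
  have hdisj : Disjoint (g '' Metric.closedBall 0 1) (Set.Ici b) := by
    rw [Set.disjoint_left]
    rintro _ ⟨w, hw, rfl⟩ hb
    obtain ⟨m, hm⟩ := hne w (mem_closedBall_zero_iff.1 hw)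
    exact absurd (hb m) (not_le.2 hm)
  obtain ⟨f, r, s, hf1, hrs, hf2⟩ := geometric_hahn_banach_compact_closed
    ((convex_closedBall (0 : EuclideanSpace ℂ J →L[ℂ] EuclideanSpace ℂ I) 1).linear_image g)
    ((isCompact_closedBall _ _).image hgc) (convex_Ici b) isClosed_Ici hdisj
  let p : Fin n → ℝ := fun m => f (Pi.single m 1)
  have hf : ∀ y, f y = ∑ m, p m * y m := fun y => by
    conv_lhs => rw [pi_eq_sum_univ' y]
    simp [p, mul_comm]
  have hp : ∀ m, 0 ≤ p m := fun m => by
    by_contra! hneg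
    have hb := hf2 (b + Pi.single m ((f b - s) / (-p m))) (by
      rw [Set.mem_Ici]
      refine le_add_of_nonneg_right ?_
      rw [Pi.single_nonneg]
      exact div_nonneg (by linarith [hf2 b Set.self_mem_Ici]) (by linarith))
    have : f (Pi.single m ((f b - s) / (-p m))) = (f b - s) / (-p m) * p m := by
      rw [← smul_eq_mul, ← map_smul, ← Pi.single_smul, smul_eq_mul, mul_one]
    rw [map_add, this, div_mul_eq_mul_div, mul_div_assoc, div_neg, div_self hneg.ne] at hb
    linarith
  obtain ⟨w, hw, hle⟩ := exists_contraction_pairing_ge_of_family hA hB hδ h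
    (fun m => ((√(p m) : ℝ) : ℂ) • x m)
  have hfw := hf1 (g w) ⟨w, mem_closedBall_zero_iff.2 hw, rfl⟩
  have hfb := hf2 b Set.self_mem_Ici
  have e1 : f (g w) = ∑ m, (krausPairing A B w (((√(p m) : ℝ) : ℂ) • x m)).re := by
    rw [hf]
    refine Finset.sum_congr rfl fun m _ => ?_
    rw [krausPairing_smul_vector, Complex.re_ofReal_mul, Real.sq_sqrt (hp m)]
    rfl
  have e2 : f b = (1 - δ / 2) * ∑ m, ‖((√(p m) : ℝ) : ℂ) • x m‖ ^ 2 := by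
    rw [hf, Finset.mul_sum]
    refine Finset.sum_congr rfl fun m _ => ?_
    rw [norm_smul, mul_pow, Complex.norm_real, Real.norm_eq_abs, sq_abs, Real.sq_sqrt (hp m)]
    ring
  linarith

/-- Continuity of the Stinespring representation: if two channels in Kraus form are close in
cb-norm, then a single contraction `w` makes their Kraus families overlap on all vectors. -/
theorem exists_contraction_pairing_ge {A : I → H₁ →L[ℂ] H₂} {B : J → H₁ →L[ℂ] H₂}
    (hA : IsKrausIsometry A) (hB : IsKrausIsometry B) {δ : ℝ} (hδ : 0 ≤ δ)
    (h : cbNorm (krausMap A A - krausMap B B) ≤ ENNReal.ofReal δ) :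
    ∃ w : EuclideanSpace ℂ J →L[ℂ] EuclideanSpace ℂ I, ‖w‖ ≤ 1 ∧
      ∀ x, (1 - δ / 2) * ‖x‖ ^ 2 ≤ (krausPairing A B w x).re := by
  have hproper : ProperSpace (EuclideanSpace ℂ J →L[ℂ] EuclideanSpace ℂ I) :=
    FiniteDimensional.proper ℂ _
  have hne := (isCompact_closedBall (0 : EuclideanSpace ℂ J →L[ℂ] EuclideanSpace ℂ I)
    1).inter_iInter_nonempty
    (fun x : H₁ => {w | (1 - δ / 2) * ‖x‖ ^ 2 ≤ (krausPairing A B w x).re})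
    (fun x => isClosed_le continuous_const (continuous_krausPairing A B x)) fun t => by
      obtain ⟨w, hw, hle⟩ := exists_contraction_pairing_ge_finite hA hB hδ h
        (fun m => (t.equivFin.symm m : H₁))
      refine ⟨w, mem_closedBall_zero_iff.2 hw, Set.mem_iInter₂.2 fun x hx => ?_⟩
      simpa using hle (t.equivFin ⟨x, hx⟩)
  obtain ⟨w, hw, hle⟩ := hne
  exact ⟨w, mem_closedBall_zero_iff.1 hw, fun x => Set.mem_iInter.1 hle x⟩

end Continuity

/-! ### Kraus forms of channels -/

section Choi

theorem inner_self_eq_ofReal_norm_sq {H : Type*} [NormedAddCommGroup H] [InnerProductSpace ℂ H]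
    (x : H) : (inner ℂ x x : ℂ) = ((‖x‖ ^ 2 : ℝ) : ℂ) := by
  rw [inner_self_eq_norm_sq_to_K]
  norm_cast

variable {ι κ H₁ H₂ H₃ : Type*} [Fintype ι] [Fintype κ]
  [NormedAddCommGroup H₁] [InnerProductSpace ℂ H₁]
  [NormedAddCommGroup H₂] [InnerProductSpace ℂ H₂]
  [NormedAddCommGroup H₃] [InnerProductSpace ℂ H₃]

theorem isKrausIsometry_smul_one {s : ι → ℂ} (hs : ∑ i, ‖s i‖ ^ 2 = 1) :
    IsKrausIsometry (fun i => s i • (1 : H₁ →L[ℂ] H₁)) := fun x => by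
  simp [norm_smul, mul_pow, ← Finset.sum_mul, hs]

theorem IsKrausIsometry.comp {A : ι → H₁ →L[ℂ] H₂} {B : κ → H₂ →L[ℂ] H₃}
    (hA : IsKrausIsometry A) (hB : IsKrausIsometry B) :
    IsKrausIsometry (fun p : κ × ι => B p.1 ∘L A p.2) := fun x => by
  rw [Fintype.sum_prod_type_right, ← hA x]
  exact Finset.sum_congr rfl fun i _ => hB (A i x)

/-- Two isometric families with large overlap are close to each other. -/
theorem IsKrausIsometry.isColumnBound_sub {A B : ι → H₁ →L[ℂ] H₂} (hA : IsKrausIsometry A)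
    (hB : IsKrausIsometry B) {δ : ℝ} (hδ : 0 ≤ δ)
    (h : ∀ x, (1 - δ / 2) * ‖x‖ ^ 2 ≤ (∑ i, inner ℂ (B i x) (A i x) : ℂ).re) :
    IsColumnBound (fun i => A i - B i) √δ := by
  refine ⟨Real.sqrt_nonneg _, fun x => ?_⟩
  have : ∀ i, ‖(A i - B i) x‖ ^ 2 =
      ‖A i x‖ ^ 2 - 2 * (inner ℂ (B i x) (A i x) : ℂ).re + ‖B i x‖ ^ 2 :=
    fun i => by
      rw [sub_apply, @norm_sub_sq ℂ, ← inner_conj_symm, RCLike.conj_re]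
      rfl
  have hx := h x
  rw [Complex.re_sum] at hx
  simp only [this, Finset.sum_add_distrib, Finset.sum_sub_distrib, hA x, hB x, ← Finset.mul_sum,
    Real.sq_sqrt hδ]
  linarith

variable [FiniteDimensional ℂ H₁] [FiniteDimensional ℂ H₂] [FiniteDimensional ℂ H₃]

open InnerProductSpace in
/-- Choi's theorem: every quantum channel has a Kraus form. -/
theorem QuantumChannel.exists_eq_krausMap (T : QuantumChannel H₂ H₁) :
    ∃ (m : ℕ) (A : Fin m → H₁ →L[ℂ] H₂), T.toLinearMap = krausMap A A := by
  let a := stdOrthonormalBasis ℂ H₂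
  let X : CStarMatrix (Fin (Module.finrank ℂ H₂)) (Fin (Module.finrank ℂ H₂)) (H₂ →L[ℂ] H₂) :=
    CStarMatrix.ofMatrix fun i j => rankOne ℂ (a i) (a j)
  have hX : 0 ≤ X := by
    apply cstarMatrix_nonneg_of_isPositive
    have : blockOperator X =
        rankOne ℂ (WithLp.toLp 2 fun i => a i) (WithLp.toLp 2 fun i => a i) := by
      ext x i
      rw [blockOperator_apply]
      simp only [rankOne_apply, PiLp.inner_apply, Finset.sum_smul, WithLp.ofLp_sum,
        Finset.sum_apply]
      rfl
    rw [this]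
    exact isPositive_rankOne_self _
  obtain ⟨m, u, hu⟩ := ContinuousLinearMap.isPositive_iff_eq_sum_rankOne.1
    (isPositive_blockOperator (T.map_cstarMatrix_nonneg' _ X hX))
  have hT : ∀ i j, T.toLinearMap (rankOne ℂ (a i) (a j)) = ∑ f, rankOne ℂ (u f i) (u f j) := by
    intro i j
    ext v
    have h := congrArg (fun P => P (PiLp.single 2 j v) i) hu
    simp only [blockOperator_single] at h
    refine h.trans ?_
    rw [sum_apply, sum_apply, WithLp.ofLp_sum, Finset.sum_apply]
    refine Finset.sum_congr rfl fun f _ => ?_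
    rw [rankOne_apply, rankOne_apply, PiLp.smul_apply, PiLp.inner_apply, Finset.sum_eq_single j]
    · simp
    · intro k _ hk
      simp [hk]
    · simp
  let A : Fin m → H₁ →L[ℂ] H₂ := fun f => ∑ i, rankOne ℂ (a i) (u f i)
  have hA : ∀ f i x, inner ℂ (a i) (A f x) = (inner ℂ (u f i) x : ℂ) := fun f i x => by
    simp only [A, sum_apply, inner_sum, rankOne_apply, inner_smul_right]
    rw [Finset.sum_eq_single i]
    · simp
    · intro k _ hk
      simp [a.inner_eq_ite, hk.symm]
    · simp
  refine ⟨m, A, LinearMap.ext fun e => ?_⟩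
  have he : e = ∑ i, ∑ j, (inner ℂ (a i) (e (a j)) : ℂ) • rankOne ℂ (a i) (a j) := by
    ext x
    conv_lhs => rw [← a.sum_repr' x, map_sum]
    simp only [sum_apply, smul_apply, rankOne_apply, map_smul]
    rw [Finset.sum_comm]
    refine Finset.sum_congr rfl fun j _ => ?_
    conv_lhs => rw [← a.sum_repr' (e (a j)), Finset.smul_sum]
    exact Finset.sum_congr rfl fun i _ => smul_comm _ _ _
  rw [he]
  simp only [map_sum, map_smul]
  refine Finset.sum_congr rfl fun i _ => Finset.sum_congr rfl fun j _ => ?_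
  congr 1
  rw [hT]
  refine ContinuousLinearMap.ext fun y => ext_inner_left ℂ fun x => ?_
  rw [inner_krausMap]
  simp only [sum_apply, inner_sum, rankOne_apply, inner_smul_right, hA]
  refine Finset.sum_congr rfl fun f _ => ?_
  rw [← inner_conj_symm (A f x), hA, inner_conj_symm]

/-- A Kraus map is unital precisely if its Kraus family is isometric. -/
theorem krausMap_one_eq_one_iff {A : ι → H₁ →L[ℂ] H₂} :
    krausMap A A 1 = 1 ↔ IsKrausIsometry A := by
  have key : ∀ x, (inner ℂ x (krausMap A A 1 x) : ℂ) = (∑ i, ‖A i x‖ ^ 2 : ℝ) := fun x => by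
    rw [inner_krausMap]
    push_cast
    refine Finset.sum_congr rfl fun i _ => ?_
    exact inner_self_eq_norm_sq_to_K _
  constructor
  · intro h x
    have := key x
    rw [h, one_apply_eq_self, inner_self_eq_ofReal_norm_sq] at this
    exact Complex.ofReal_injective this.symm
  · intro h
    rw [← ContinuousLinearMap.coe_inj]
    refine (ext_inner_map _ _).1 fun x => ?_
    change (inner ℂ (krausMap A A 1 x) x : ℂ) = inner ℂ x x
    rw [← inner_conj_symm, key, h x, inner_self_eq_ofReal_norm_sq, Complex.conj_ofReal]

theorem krausMap_comp_krausMap (A : ι → H₁ →L[ℂ] H₂) (B : κ → H₂ →L[ℂ] H₃) :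
    krausMap A A ∘ₗ krausMap B B =
      krausMap (fun p : κ × ι => B p.1 ∘L A p.2) (fun p : κ × ι => B p.1 ∘L A p.2) := by
  refine LinearMap.ext fun e => ContinuousLinearMap.ext fun y => ext_inner_left ℂ fun x => ?_
  rw [LinearMap.comp_apply, inner_krausMap, inner_krausMap, Fintype.sum_prod_type_right]
  exact Finset.sum_congr rfl fun i _ => inner_krausMap _ _ _ _ _

theorem krausMap_smul_one {s : ι → ℂ} (hs : ∑ i, ‖s i‖ ^ 2 = 1) :
    krausMap (fun i => s i • (1 : H₁ →L[ℂ] H₁)) (fun i => s i • (1 : H₁ →L[ℂ] H₁)) =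
      LinearMap.id := by
  refine LinearMap.ext fun e => ContinuousLinearMap.ext fun y => ext_inner_left ℂ fun x => ?_
  rw [inner_krausMap]
  simp only [smul_apply, one_apply_eq_self, map_smul, inner_smul_left, inner_smul_right,
    ← mul_assoc, ← Finset.sum_mul, Complex.mul_conj', LinearMap.id_apply]
  rw [show ∑ i, (‖s i‖ : ℂ) ^ 2 = 1 by exact_mod_cast hs, one_mul]

open InnerProductSpace in
/-- A contractive family of Kraus operators extends to an isometric one: write the defect
`1 - ∑ᵢ Wᵢ† Wᵢ` as `∑ₗ |uₗ⟩⟨uₗ|` and add the operators `|a⟩⟨uₗ|` for a unit vector `a`. -/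
theorem exists_extend_isKrausIsometry [Nontrivial H₂] {W : ι → H₁ →L[ℂ] H₂}
    (hW : IsColumnBound W 1) :
    ∃ (m : ℕ) (R : Fin m → H₁ →L[ℂ] H₂), IsKrausIsometry (Sum.elim W R) := by
  obtain ⟨a, ha⟩ := exists_norm_eq H₂ zero_le_one
  have hre : ∀ x, (inner ℂ ((1 - krausMap W W 1) x) x : ℂ) =
      (‖x‖ ^ 2 - ∑ i, ‖W i x‖ ^ 2 : ℝ) := fun x => by
    rw [← inner_conj_symm, sub_apply, inner_sub_right, inner_krausMap]
    simp only [one_apply_eq_self, inner_self_eq_ofReal_norm_sq, ← Complex.ofReal_sum,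
      ← Complex.ofReal_sub, Complex.conj_ofReal]
  have hpos : (1 - krausMap W W 1).IsPositive := by
    rw [ContinuousLinearMap.isPositive_iff_complex]
    intro x
    rw [hre]
    refine ⟨congrArg _ (Complex.ofReal_re _), ?_⟩
    have := hW.2 x
    simp only [RCLike.re_to_complex, Complex.ofReal_re]
    linarith
  obtain ⟨m, u, hu⟩ := ContinuousLinearMap.isPositive_iff_eq_sum_rankOne.1 hpos
  refine ⟨m, fun i => rankOne ℂ a (u i), fun x => ?_⟩
  have h := hre x
  rw [hu] at h
  simp only [sum_apply, sum_inner, rankOne_apply, inner_smul_left] at h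
  have h2 : ∑ i, ‖(inner ℂ (u i) x : ℂ)‖ ^ 2 = ‖x‖ ^ 2 - ∑ i, ‖W i x‖ ^ 2 := by
    apply Complex.ofReal_injective
    rw [← h]
    push_cast
    exact Finset.sum_congr rfl fun i _ => (Complex.conj_mul' _).symm
  simp only [Fintype.sum_sum_type, Sum.elim_inl, Sum.elim_inr, rankOne_apply, norm_smul, ha,
    mul_one, h2]
  ring

end Choi

/-! ### Complementary Kraus families -/

section Complementary

variable {ι β κ H₁ H₂ H₃ : Type*} [Fintype ι] [Fintype β] [Fintype κ]
  [NormedAddCommGroup H₁] [InnerProductSpace ℂ H₁]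
  [NormedAddCommGroup H₂] [InnerProductSpace ℂ H₂]
  [NormedAddCommGroup H₃] [InnerProductSpace ℂ H₃]

/-- The Kraus family of the complementary channel: for the Stinespring operator
`V x = ∑ₖ Aₖ x ⊗ eₖ` it consists of the operators `Aᶜⱼ` with `V x = ∑ⱼ bⱼ ⊗ Aᶜⱼ x`, that is
`Aᶜⱼ x = ∑ₖ ⟪bⱼ, Aₖ x⟫ eₖ`. -/
def complementaryFamily (b : OrthonormalBasis β ℂ H₂) (e : OrthonormalBasis κ ℂ H₃)
    (A : κ → H₁ →L[ℂ] H₂) (j : β) : H₁ →L[ℂ] H₃ :=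
  ∑ k, InnerProductSpace.rankOne ℂ (e k) (b j) ∘L A k

theorem complementaryFamily_apply (b : OrthonormalBasis β ℂ H₂) (e : OrthonormalBasis κ ℂ H₃)
    (A : κ → H₁ →L[ℂ] H₂) (j : β) (x : H₁) :
    complementaryFamily b e A j x = ∑ k, (inner ℂ (b j) (A k x) : ℂ) • e k := by
  simp [complementaryFamily, sum_apply]

theorem inner_complementaryFamily (b : OrthonormalBasis β ℂ H₂) (e : OrthonormalBasis κ ℂ H₃)
    (A : κ → H₁ →L[ℂ] H₂) (j : β) (k : κ) (x : H₁) :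
    inner ℂ (e k) (complementaryFamily b e A j x) = (inner ℂ (b j) (A k x) : ℂ) := by
  rw [complementaryFamily_apply, e.orthonormal.inner_right_fintype]

theorem sum_norm_complementaryFamily_sq (b : OrthonormalBasis β ℂ H₂) (e : OrthonormalBasis κ ℂ H₃)
    (A : κ → H₁ →L[ℂ] H₂) (x : H₁) :
    ∑ j, ‖complementaryFamily b e A j x‖ ^ 2 = ∑ k, ‖A k x‖ ^ 2 := by
  simp_rw [← e.sum_sq_norm_inner_right, inner_complementaryFamily, ← b.sum_sq_norm_inner_right]
  exact Finset.sum_comm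

theorem complementaryFamily_sub (b : OrthonormalBasis β ℂ H₂) (e : OrthonormalBasis κ ℂ H₃)
    (A B : κ → H₁ →L[ℂ] H₂) (j : β) :
    complementaryFamily b e (fun k => A k - B k) j =
      complementaryFamily b e A j - complementaryFamily b e B j := by
  simp [complementaryFamily]

theorem complementaryFamily_smul_one (a : OrthonormalBasis β ℂ H₁) (e : OrthonormalBasis κ ℂ H₃)
    (s : κ → ℂ) (j : β) :
    complementaryFamily a e (fun k => s k • (1 : H₁ →L[ℂ] H₁)) j =
      InnerProductSpace.rankOne ℂ (∑ k, s k • e k) (a j) := by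
  ext x
  simp only [complementaryFamily_apply, smul_apply, one_apply_eq_self, inner_smul_right,
    InnerProductSpace.rankOne_apply, Finset.smul_sum, smul_smul]
  exact Finset.sum_congr rfl fun k _ => by rw [mul_comm]

variable [FiniteDimensional ℂ H₁] [FiniteDimensional ℂ H₃]

theorem inner_krausMap_complementaryFamily (b : OrthonormalBasis β ℂ H₂)
    (e : OrthonormalBasis κ ℂ H₃) (A : κ → H₁ →L[ℂ] H₂) (f : H₃ →L[ℂ] H₃) (x y : H₁) :
    inner ℂ x (krausMap (complementaryFamily b e A) (complementaryFamily b e A) f y) =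
      ∑ k, ∑ l, (inner ℂ (e k) (f (e l)) : ℂ) * inner ℂ (A k x) (A l y) := by
  simp only [inner_krausMap, complementaryFamily_apply, map_sum, sum_inner, inner_sum, map_smul,
    inner_smul_left, inner_smul_right]
  refine Finset.sum_comm.trans (Eq.trans ?_ Finset.sum_comm)
  refine Finset.sum_congr rfl fun l _ => ?_
  simp_rw [Finset.mul_sum]
  rw [Finset.sum_comm]
  refine Finset.sum_congr rfl fun k _ => ?_
  rw [← b.sum_inner_mul_inner (A k x), Finset.mul_sum]
  refine Finset.sum_congr rfl fun j _ => ?_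
  rw [inner_conj_symm]
  ring

/-- The map `e ↦ V† (1 ⊗ e) V` does not change when an isometry is applied to the first tensor
factor. Here the isometry is given by the Kraus family `W`. -/
theorem krausMap_complementaryFamily_comp {H₄ γ : Type*} [Fintype γ] [NormedAddCommGroup H₄]
    [InnerProductSpace ℂ H₄] [FiniteDimensional ℂ H₂]
    [FiniteDimensional ℂ H₄] (b : OrthonormalBasis β ℂ H₂) (a : OrthonormalBasis γ ℂ H₄)
    (e : OrthonormalBasis κ ℂ H₃) (A : κ → H₁ →L[ℂ] H₂) {W : ι → H₂ →L[ℂ] H₄}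
    (hW : IsKrausIsometry W) :
    krausMap (fun p : ι × γ => complementaryFamily a e (fun k => W p.1 ∘L A k) p.2)
        (fun p : ι × γ => complementaryFamily a e (fun k => W p.1 ∘L A k) p.2) =
      krausMap (complementaryFamily b e A) (complementaryFamily b e A) := by
  refine LinearMap.ext fun f => ContinuousLinearMap.ext fun y => ext_inner_left ℂ fun x => ?_
  rw [inner_krausMap_complementaryFamily, inner_krausMap, Fintype.sum_prod_type]
  have h : ∀ i, ∑ j, inner ℂ (complementaryFamily a e (fun k => W i ∘L A k) j x)
      (f (complementaryFamily a e (fun k => W i ∘L A k) j y)) =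
      ∑ k, ∑ l, (inner ℂ (e k) (f (e l)) : ℂ) * inner ℂ (W i (A k x)) (W i (A l y)) := fun i => by
    rw [← inner_krausMap, inner_krausMap_complementaryFamily]
    rfl
  have hW1 : ∀ u v, ∑ i, inner ℂ (W i u) (W i v) = (inner ℂ u v : ℂ) := fun u v => by
    have := inner_krausMap W W 1 u v
    rw [krausMap_one_eq_one_iff.2 hW] at this
    exact this.symm
  simp only [h]
  rw [Finset.sum_comm]
  refine Finset.sum_congr rfl fun k _ => ?_
  rw [Finset.sum_comm]
  refine Finset.sum_congr rfl fun l _ => ?_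
  rw [← Finset.mul_sum, hW1]

end Complementary

/-! ### Kraus operators of a Stinespring representation -/

section Stinespring

variable {β κ HA HB HE : Type*} [Fintype β] [Fintype κ]
  [NormedAddCommGroup HA] [InnerProductSpace ℂ HA]
  [NormedAddCommGroup HB] [InnerProductSpace ℂ HB]
  [NormedAddCommGroup HE] [InnerProductSpace ℂ HE]

/-- The slices of `V` along an orthonormal basis of the second factor. They are the Kraus operators
of `b ↦ V† (b ⊗ 1) V`. -/
theorem exists_eq_sum_tmul (b : OrthonormalBasis β ℂ HB) (e : OrthonormalBasis κ ℂ HE)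
    (V : HA →L[ℂ] HB ⊗[ℂ] HE) :
    ∃ A : κ → HA →L[ℂ] HB, ∀ x, V x = ∑ k, A k x ⊗ₜ[ℂ] e k := by
  refine ⟨fun k => ∑ j, InnerProductSpace.rankOne ℂ (b j) (b j ⊗ₜ[ℂ] e k) ∘L V, fun x => ?_⟩
  conv_lhs => rw [← (b.tensorProduct e).sum_repr' (V x)]
  rw [Fintype.sum_prod_type_right]
  refine Finset.sum_congr rfl fun k _ => ?_
  simp [sum_apply, TensorProduct.sum_tmul, TensorProduct.smul_tmul']

variable [FiniteDimensional ℂ HA] [FiniteDimensional ℂ HB] [FiniteDimensional ℂ HE]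

theorem IsStinespringRepresentation.toLinearMap_eq_krausMap {T : QuantumChannel HB HA}
    {V : HA →L[ℂ] HB ⊗[ℂ] HE} (hV : IsStinespringRepresentation T V)
    (e : OrthonormalBasis κ ℂ HE) {A : κ → HA →L[ℂ] HB}
    (hA : ∀ x, V x = ∑ k, A k x ⊗ₜ[ℂ] e k) : T.toLinearMap = krausMap A A := by
  classical
  refine LinearMap.ext fun c => ContinuousLinearMap.ext fun y => ext_inner_left ℂ fun x => ?_
  rw [hV c, inner_krausMap, ContinuousLinearMap.comp_apply,
    ContinuousLinearMap.adjoint_inner_right, ContinuousLinearMap.comp_apply, hA x, hA y]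
  simp only [map_sum, TensorProduct.mapL_tmul, sum_inner, inner_sum, TensorProduct.inner_tmul,
    ContinuousLinearMap.id_apply, e.inner_eq_ite]
  simp

theorem complementaryChannel_eq_krausMap {V : HA →L[ℂ] HB ⊗[ℂ] HE} (b : OrthonormalBasis β ℂ HB)
    (e : OrthonormalBasis κ ℂ HE) {A : κ → HA →L[ℂ] HB}
    (hA : ∀ x, V x = ∑ k, A k x ⊗ₜ[ℂ] e k) :
    complementaryChannel V = krausMap (complementaryFamily b e A) (complementaryFamily b e A) := by
  refine LinearMap.ext fun f => ContinuousLinearMap.ext fun y => ext_inner_left ℂ fun x => ?_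
  rw [inner_krausMap_complementaryFamily]
  change inner ℂ x (ContinuousLinearMap.adjoint V
    (TensorProduct.mapL (ContinuousLinearMap.id ℂ HB) f (V y))) = _
  rw [ContinuousLinearMap.adjoint_inner_right, hA x, hA y]
  simp only [map_sum, TensorProduct.mapL_tmul, sum_inner, inner_sum, TensorProduct.inner_tmul,
    ContinuousLinearMap.id_apply]
  rw [Finset.sum_comm]
  exact Finset.sum_congr rfl fun k _ => Finset.sum_congr rfl fun l _ => mul_comm _ _

end Stinespring

/-! ### States and depolarizing channels -/

section Depolarizing

variable {ι α HA HE : Type*} [Fintype ι] [Fintype α]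
  [NormedAddCommGroup HA] [InnerProductSpace ℂ HA]
  [NormedAddCommGroup HE] [InnerProductSpace ℂ HE]

open InnerProductSpace in
theorem isKrausIsometry_rankOne (a : OrthonormalBasis α ℂ HA) {s : ι → HE}
    (hs : ∑ i, ‖s i‖ ^ 2 = 1) :
    IsKrausIsometry (fun p : ι × α => rankOne ℂ (s p.1) (a p.2)) := fun x => by
  simp only [rankOne_apply, norm_smul, mul_pow, Fintype.sum_prod_type, ← Finset.sum_mul,
    a.sum_sq_norm_inner_right, ← Finset.mul_sum, hs, mul_one]

variable [FiniteDimensional ℂ HA] [FiniteDimensional ℂ HE]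

open InnerProductSpace in
theorem trace_sum_rankOne_mul (s : ι → HE) (f : HE →L[ℂ] HE) :
    LinearMap.trace ℂ HE ((∑ i, rankOne ℂ (s i) (s i)) * f).toLinearMap =
      ∑ i, inner ℂ (s i) (f (s i)) := by
  let e := stdOrthonormalBasis ℂ HE
  rw [LinearMap.trace_eq_sum_inner _ e]
  have : ∀ k, (inner ℂ (e k) (((∑ i, rankOne ℂ (s i) (s i)) * f).toLinearMap (e k)) : ℂ) =
      ∑ i, inner ℂ (ContinuousLinearMap.adjoint f (s i)) (e k) * inner ℂ (e k) (s i) := fun k => by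
    change inner ℂ (e k) ((∑ i, rankOne ℂ (s i) (s i)) (f (e k))) = _
    rw [sum_apply, inner_sum]
    refine Finset.sum_congr rfl fun i _ => ?_
    rw [rankOne_apply, inner_smul_right, ContinuousLinearMap.adjoint_inner_left]
  simp only [this]
  rw [Finset.sum_comm]
  refine Finset.sum_congr rfl fun i _ => ?_
  rw [e.sum_inner_mul_inner, ContinuousLinearMap.adjoint_inner_left]

open InnerProductSpace in
theorem isQuantumState_iff_exists {σ : HE →L[ℂ] HE} :
    IsQuantumState σ ↔ ∃ (m : ℕ) (s : Fin m → HE), σ = ∑ i, rankOne ℂ (s i) (s i) ∧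
      ∑ i, ‖s i‖ ^ 2 = 1 := by
  have htr : ∀ (m : ℕ) (s : Fin m → HE), LinearMap.trace ℂ HE
      (∑ i, rankOne ℂ (s i) (s i) : HE →L[ℂ] HE).toLinearMap = (∑ i, ‖s i‖ ^ 2 : ℝ) := fun m s => by
    have h := trace_sum_rankOne_mul s 1
    rw [mul_one] at h
    rw [h, Complex.ofReal_sum]
    exact Finset.sum_congr rfl fun i _ => inner_self_eq_ofReal_norm_sq _
  rw [IsQuantumState, ContinuousLinearMap.nonneg_iff_isPositive,
    ContinuousLinearMap.isPositive_iff_eq_sum_rankOne]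
  constructor
  · rintro ⟨⟨m, s, rfl⟩, h⟩
    rw [htr] at h
    exact ⟨m, s, rfl, Complex.ofReal_injective h⟩
  · rintro ⟨m, s, rfl, h⟩
    exact ⟨⟨m, s, rfl⟩, by rw [htr, h, Complex.ofReal_one]⟩

open InnerProductSpace in
/-- Kraus form of the depolarizing channel, coming from a decomposition of the state into rank one
operators. -/
theorem depolarizingChannel_eq_krausMap (a : OrthonormalBasis α ℂ HA) (s : ι → HE) :
    depolarizingChannel HA (∑ i, rankOne ℂ (s i) (s i)) =
      krausMap (fun p : ι × α => rankOne ℂ (s p.1) (a p.2))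
        (fun p : ι × α => rankOne ℂ (s p.1) (a p.2)) := by
  refine LinearMap.ext fun f => ContinuousLinearMap.ext fun y => ext_inner_left ℂ fun x => ?_
  change inner ℂ x (LinearMap.trace ℂ HE ((∑ i, rankOne ℂ (s i) (s i)) * f).toLinearMap • y) = _
  rw [trace_sum_rankOne_mul, inner_smul_right, inner_krausMap, Fintype.sum_prod_type,
    Finset.sum_mul]
  refine Finset.sum_congr rfl fun i _ => ?_
  simp only [rankOne_apply, map_smul, inner_smul_left, inner_smul_right]
  rw [← a.sum_inner_mul_inner x y, Finset.mul_sum]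
  refine Finset.sum_congr rfl fun j _ => ?_
  rw [inner_conj_symm]
  ring

end Depolarizing

/-! ### The information-disturbance tradeoff -/

section Tradeoff

/-- The transpose of a contraction is a contraction. -/
theorem sum_norm_transpose_sq_le {I J : Type*} [Fintype I] [Fintype J] [DecidableEq J]
    {w : EuclideanSpace ℂ J →L[ℂ] EuclideanSpace ℂ I} (hw : ‖w‖ ≤ 1) (c : I → ℂ) :
    ∑ j, ‖∑ i, w (EuclideanSpace.single j 1) i * c i‖ ^ 2 ≤ ∑ i, ‖c i‖ ^ 2 := by
  let d : EuclideanSpace ℂ I := WithLp.toLp 2 fun i => starRingEnd ℂ (c i)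
  have hd : ‖d‖ ^ 2 = ∑ i, ‖c i‖ ^ 2 := by
    simp [d, EuclideanSpace.norm_sq_eq]
  have hj : ∀ j, ‖ContinuousLinearMap.adjoint w d j‖ =
      ‖∑ i, w (EuclideanSpace.single j 1) i * c i‖ := fun j => by
    have h1 : ContinuousLinearMap.adjoint w d j =
        inner ℂ (EuclideanSpace.single j (1 : ℂ)) (ContinuousLinearMap.adjoint w d) := by
      rw [EuclideanSpace.inner_single_left]
      simp
    rw [h1, ContinuousLinearMap.adjoint_inner_right, PiLp.inner_apply, ← RCLike.norm_conj, map_sum]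
    congr 1
    refine Finset.sum_congr rfl fun i _ => ?_
    simp [d, mul_comm]
  rw [← hd]
  calc _ = ‖ContinuousLinearMap.adjoint w d‖ ^ 2 := by
        rw [EuclideanSpace.norm_sq_eq]
        exact Finset.sum_congr rfl fun j _ => by rw [hj]
    _ ≤ ‖d‖ ^ 2 := by
        gcongr
        refine (ContinuousLinearMap.le_opNorm _ _).trans ?_
        rw [LinearIsometryEquiv.norm_map]
        exact mul_le_of_le_one_left (norm_nonneg _) hw

variable {HA HB HE : Type*}
  [NormedAddCommGroup HA] [InnerProductSpace ℂ HA] [FiniteDimensional ℂ HA]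
  [NormedAddCommGroup HB] [InnerProductSpace ℂ HB] [FiniteDimensional ℂ HB]
  [NormedAddCommGroup HE] [InnerProductSpace ℂ HE] [FiniteDimensional ℂ HE]
  {TB : QuantumChannel HB HA} {V : HA →L[ℂ] HB ⊗[ℂ] HE}

theorem exists_kraus_of_isStinespringRepresentation (hV : IsStinespringRepresentation TB V) :
    ∃ A : Fin (Module.finrank ℂ HE) → HA →L[ℂ] HB,
      IsKrausIsometry A ∧ TB.toLinearMap = krausMap A A ∧
      complementaryChannel V =
        krausMap (complementaryFamily (stdOrthonormalBasis ℂ HB) (stdOrthonormalBasis ℂ HE) A)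
          (complementaryFamily (stdOrthonormalBasis ℂ HB) (stdOrthonormalBasis ℂ HE) A) := by
  obtain ⟨A, hA⟩ := exists_eq_sum_tmul (stdOrthonormalBasis ℂ HB) (stdOrthonormalBasis ℂ HE) V
  have hT := hV.toLinearMap_eq_krausMap _ hA
  exact ⟨A, krausMap_one_eq_one_iff.1 (hT ▸ TB.map_one'), hT,
    complementaryChannel_eq_krausMap _ _ hA⟩

open InnerProductSpace in
/-- Little information in the environment makes decoding possible. The contraction comparing the
Kraus families of the complementary and of the depolarizing channel, reshaped into operators
`HB → HA`, is a contractive Kraus family, and its isometric extension is the decoder. -/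
theorem decodingError_le_of_cbNorm_le [Nontrivial HA] (hV : IsStinespringRepresentation TB V)
    {σ : HE →L[ℂ] HE} (hσ : IsQuantumState σ) {δ : ℝ} (hδ : 0 ≤ δ)
    (h : cbNorm (complementaryChannel V - depolarizingChannel HA σ) ≤ ENNReal.ofReal δ) :
    decodingError TB ≤ ENNReal.ofReal (2 * √δ) := by
  obtain ⟨A, hA, hT, hTE⟩ := exists_kraus_of_isStinespringRepresentation hV
  obtain ⟨m, s, rfl, hs⟩ := isQuantumState_iff_exists.1 hσ
  let a := stdOrthonormalBasis ℂ HA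
  let b := stdOrthonormalBasis ℂ HB
  let e := stdOrthonormalBasis ℂ HE
  rw [hTE, depolarizingChannel_eq_krausMap a] at h
  have hE : IsKrausIsometry (complementaryFamily b e A) := fun x => by
    rw [sum_norm_complementaryFamily_sq, hA x]
  obtain ⟨w, hw, hwx⟩ := exists_contraction_pairing_ge hE (isKrausIsometry_rankOne a hs) hδ h
  let W : Fin m → HB →L[ℂ] HA := fun f => ∑ j, ∑ i,
    w (EuclideanSpace.single (f, j) 1) i • rankOne ℂ (a j) (b i)
  have hWin : ∀ f j y, inner ℂ (a j) (W f y) =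
      ∑ i, w (EuclideanSpace.single (f, j) 1) i * (inner ℂ (b i) y : ℂ) := fun f j y => by
    have : W f y =
        ∑ j, (∑ i, w (EuclideanSpace.single (f, j) 1) i * (inner ℂ (b i) y : ℂ)) • a j := by
      simp only [W, sum_apply, smul_apply, rankOne_apply, Finset.sum_smul, smul_smul]
    rw [this, a.orthonormal.inner_right_fintype]
  have hW : IsColumnBound W 1 := ⟨zero_le_one, fun y => by
    rw [one_pow, one_mul, ← b.sum_sq_norm_inner_right y]
    simp_rw [← a.sum_sq_norm_inner_right, hWin]
    rw [← Fintype.sum_prod_type' (f := fun f j =>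
      ‖∑ i, w (EuclideanSpace.single (f, j) 1) i * (inner ℂ (b i) y : ℂ)‖ ^ 2)]
    exact sum_norm_transpose_sq_le hw _⟩
  obtain ⟨l, R, hR⟩ := exists_extend_isKrausIsometry hW
  let D : QuantumChannel HA HB := krausChannel (Sum.elim W R) (krausMap_one_eq_one_iff.2 hR)
  -- the identity channel in a Kraus form with the index set of `TB ∘ D`
  let t : (Fin m ⊕ Fin l) × Fin (Module.finrank ℂ HE) → ℂ := fun p =>
    Sum.elim (fun f => inner ℂ (e p.2) (s f)) (fun _ => 0) p.1
  have ht : ∑ p, ‖t p‖ ^ 2 = 1 := by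
    simp [t, Fintype.sum_prod_type, e.sum_sq_norm_inner_right, hs]
  have hpair : ∀ x, krausPairing (complementaryFamily b e A)
      (fun p : Fin m × _ => rankOne ℂ (s p.1) (a p.2)) w x =
      ∑ p : (Fin m ⊕ Fin l) × Fin (Module.finrank ℂ HE),
        inner ℂ ((t p • (1 : HA →L[ℂ] HA)) x) ((Sum.elim W R p.1 ∘L A p.2) x) := fun x => by
    have h1 : ∀ f j, (inner ℂ (s f)
        (∑ i, w (EuclideanSpace.single (f, j) 1) i • complementaryFamily b e A i x) : ℂ) =
        ∑ k, inner ℂ (s f) (e k) * inner ℂ (a j) (W f (A k x)) := fun f j => by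
      rw [← e.sum_inner_mul_inner]
      refine Finset.sum_congr rfl fun k _ => ?_
      rw [hWin, inner_sum]
      simp only [inner_smul_right, inner_complementaryFamily]
    rw [Fintype.sum_prod_type, Fintype.sum_sum_type, krausPairing, Fintype.sum_prod_type]
    simp only [t, Sum.elim_inl, Sum.elim_inr, zero_smul, zero_apply, inner_zero_left,
      Finset.sum_const_zero, add_zero, smul_apply, one_apply_eq_self, inner_smul_left,
      rankOne_apply, inner_conj_symm, ContinuousLinearMap.comp_apply, h1]
    refine Finset.sum_congr rfl fun f _ => ?_
    simp_rw [Finset.mul_sum]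
    rw [Finset.sum_comm]
    refine Finset.sum_congr rfl fun k _ => ?_
    rw [← a.sum_inner_mul_inner x, Finset.mul_sum]
    exact Finset.sum_congr rfl fun j _ => mul_left_comm _ _ _
  have hcb : cbNorm (TB.toLinearMap ∘ₗ D.toLinearMap - LinearMap.id) ≤ ENNReal.ofReal (2 * √δ) := by
    have hD : TB.toLinearMap ∘ₗ D.toLinearMap = krausMap
        (fun p : (Fin m ⊕ Fin l) × Fin (Module.finrank ℂ HE) => Sum.elim W R p.1 ∘L A p.2)
        (fun p : (Fin m ⊕ Fin l) × Fin (Module.finrank ℂ HE) => Sum.elim W R p.1 ∘L A p.2) := by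
      rw [hT, ← krausMap_comp_krausMap]
      rfl
    rw [hD, ← krausMap_smul_one ht]
    refine cbNorm_krausMap_sub_le (hA.comp hR).isColumnBound
      (isKrausIsometry_smul_one ht).isColumnBound
      ((hA.comp hR).isColumnBound_sub (isKrausIsometry_smul_one ht) hδ fun x => ?_)
    rw [← hpair]
    exact hwx x
  exact (iInf_le _ D).trans hcb

open InnerProductSpace in
/-- A good decoder leaves little information in the environment. The Kraus family of `TB ∘ D` is
close to a family `tₚ • 1` of multiples of the identity, and the state is the one purified by the
unit vector `t`. -/
theorem exists_isQuantumState_cbNorm_le [Nontrivial HA] (hV : IsStinespringRepresentation TB V)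
    (D : QuantumChannel HA HB) :
    ∃ σ : HE →L[ℂ] HE, IsQuantumState σ ∧
      cbNorm (complementaryChannel V - depolarizingChannel HA σ) ≤
        2 * cbNorm (TB.toLinearMap ∘ₗ D.toLinearMap - LinearMap.id) ^ (1 / 2 : ℝ) := by
  obtain ⟨A, hA, hT, hTE⟩ := exists_kraus_of_isStinespringRepresentation hV
  let a := stdOrthonormalBasis ℂ HA
  let b := stdOrthonormalBasis ℂ HB
  let e := stdOrthonormalBasis ℂ HE
  have hE : IsKrausIsometry (complementaryFamily b e A) := fun x => by
    rw [sum_norm_complementaryFamily_sq, hA x]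
  -- for an error of at least `1` the bound `2` on the distance of two channels suffices
  rcases le_or_gt 1 (cbNorm (TB.toLinearMap ∘ₗ D.toLinearMap - LinearMap.id)) with hc | hc
  · have hne : Nontrivial HE := by
      by_contra hcon
      rw [not_nontrivial_iff_subsingleton] at hcon
      obtain ⟨x, hx⟩ := exists_norm_eq HA zero_le_one
      have h0 := hA x
      have : IsEmpty (Fin (Module.finrank ℂ HE)) := by
        rw [Module.finrank_zero_of_subsingleton]
        infer_instance
      rw [Finset.univ_eq_empty, Finset.sum_empty, hx] at h0
      norm_num at h0
    obtain ⟨v, hv⟩ := exists_norm_eq HE zero_le_one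
    have hs : ∑ i : Fin 1, ‖(fun _ => v : Fin 1 → HE) i‖ ^ 2 = 1 := by simp [hv]
    refine ⟨∑ i : Fin 1, rankOne ℂ v v, isQuantumState_iff_exists.2 ⟨1, _, rfl, hs⟩, ?_⟩
    rw [hTE, depolarizingChannel_eq_krausMap a (fun _ : Fin 1 => v)]
    refine (cbNorm_krausMap_sub_le_two hE.isColumnBound
      (isKrausIsometry_rankOne a hs).isColumnBound).trans ?_
    exact le_mul_of_one_le_right' (ENNReal.one_le_rpow hc (by norm_num))
  · set c := cbNorm (TB.toLinearMap ∘ₗ D.toLinearMap - LinearMap.id) with hcdef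
    let δ := c.toReal
    have hδ : 0 ≤ δ := ENNReal.toReal_nonneg
    have hcδ : ENNReal.ofReal δ = c := ENNReal.ofReal_toReal hc.ne_top
    have hδ1 : δ < 1 := by
      rw [← ENNReal.toReal_one]
      exact (ENNReal.toReal_lt_toReal hc.ne_top ENNReal.one_ne_top).2 hc
    obtain ⟨m, W, hDW⟩ := D.exists_eq_krausMap
    have hW : IsKrausIsometry W := krausMap_one_eq_one_iff.1 (hDW ▸ D.map_one')
    have hone : ∑ i : Unit, ‖(fun _ => 1 : Unit → ℂ) i‖ ^ 2 = 1 := by simp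
    have hcb := hcδ.symm.le
    rw [hcdef, hT, hDW, krausMap_comp_krausMap, ← krausMap_smul_one hone] at hcb
    obtain ⟨w, hw, hwx⟩ := exists_contraction_pairing_ge (hA.comp hW)
      (isKrausIsometry_smul_one hone) hδ hcb
    let ψ := w (EuclideanSpace.single () 1)
    have hψ1 : ‖ψ‖ ≤ 1 := by
      refine (w.le_opNorm _).trans ?_
      simpa using hw
    have hψx : ∀ x, (1 - δ / 2) * ‖x‖ ^ 2 ≤ (∑ p, ψ p * inner ℂ x (W p.1 (A p.2 x)) : ℂ).re :=
      fun x => by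
        refine (hwx x).trans (le_of_eq ?_)
        simp [krausPairing, ψ]
    -- as the overlap is positive, replacing `ψ`, of norm at most `1`, by a unit vector does not
    -- decrease it
    have hψ0 : 0 < ‖ψ‖ := by
      rw [norm_pos_iff]
      intro h0
      obtain ⟨x, hx⟩ := exists_norm_eq HA zero_le_one
      have := hψx x
      rw [h0, hx] at this
      simp at this
      linarith
    let t : Fin m × Fin (Module.finrank ℂ HE) → ℂ := fun p =>
      starRingEnd ℂ (((‖ψ‖⁻¹ : ℝ) : ℂ) * ψ p)
    have ht : ∑ p, ‖t p‖ ^ 2 = 1 := by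
      simp only [t, RCLike.norm_conj, norm_mul, mul_pow, ← Finset.mul_sum,
        ← EuclideanSpace.norm_sq_eq, Complex.norm_real, norm_inv, norm_norm]
      rw [← mul_pow, inv_mul_cancel₀ hψ0.ne', one_pow]
    have htx : ∀ x, (1 - δ / 2) * ‖x‖ ^ 2 ≤
        (∑ p, inner ℂ ((t p • (1 : HA →L[ℂ] HA)) x) ((W p.1 ∘L A p.2) x) : ℂ).re := fun x => by
      have h1 : (∑ p, inner ℂ ((t p • (1 : HA →L[ℂ] HA)) x) ((W p.1 ∘L A p.2) x) : ℂ) =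
          ((‖ψ‖⁻¹ : ℝ) : ℂ) * ∑ p, ψ p * inner ℂ x (W p.1 (A p.2 x)) := by
        rw [Finset.mul_sum]
        refine Finset.sum_congr rfl fun p _ => ?_
        rw [smul_apply, one_apply_eq_self, inner_smul_left, ← mul_assoc]
        simp only [t, Complex.conj_conj]
        rfl
      rw [h1, Complex.re_ofReal_mul]
      refine (hψx x).trans (le_mul_of_one_le_left ?_ ((one_le_inv₀ hψ0).2 hψ1))
      refine le_trans ?_ (hψx x)
      exact mul_nonneg (by linarith) (sq_nonneg _)
    let s : Fin m → HE := fun f => ∑ k, t (f, k) • e k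
    have hs : ∑ f, ‖s f‖ ^ 2 = 1 := by
      rw [← ht, Fintype.sum_prod_type]
      refine Finset.sum_congr rfl fun f _ => ?_
      rw [← e.sum_sq_norm_inner_right]
      refine Finset.sum_congr rfl fun k _ => ?_
      rw [e.orthonormal.inner_right_fintype]
    refine ⟨∑ f, rankOne ℂ (s f) (s f), isQuantumState_iff_exists.2 ⟨m, s, rfl, hs⟩, ?_⟩
    have hclose := (hA.comp hW).isColumnBound_sub (isKrausIsometry_smul_one ht) hδ htx
    rw [hTE, ← krausMap_complementaryFamily_comp b a e A hW, depolarizingChannel_eq_krausMap a]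
    have hiso : IsKrausIsometry fun p : Fin m × Fin (Module.finrank ℂ HA) =>
        complementaryFamily a e (fun k => W p.1 ∘L A k) p.2 := fun x => by
      refine Eq.trans ?_ (hA.comp hW x)
      rw [Fintype.sum_prod_type, Fintype.sum_prod_type]
      exact Finset.sum_congr rfl fun f _ =>
        sum_norm_complementaryFamily_sq a e (fun k => W f ∘L A k) x
    have hfin : IsColumnBound (fun p : Fin m × Fin (Module.finrank ℂ HA) =>
        complementaryFamily a e (fun k => W p.1 ∘L A k) p.2 - rankOne ℂ (s p.1) (a p.2)) √δ := by
      refine ⟨hclose.1, fun x => le_trans (le_of_eq ?_) (hclose.2 x)⟩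
      rw [Fintype.sum_prod_type, Fintype.sum_prod_type]
      refine Finset.sum_congr rfl fun f _ => ?_
      rw [← sum_norm_complementaryFamily_sq a e]
      refine Finset.sum_congr rfl fun j _ => ?_
      rw [complementaryFamily_sub, complementaryFamily_smul_one]
    refine (cbNorm_krausMap_sub_le hiso.isColumnBound
      (isKrausIsometry_rankOne a hs).isColumnBound hfin).trans (le_of_eq ?_)
    rw [ENNReal.ofReal_mul zero_le_two, ENNReal.ofReal_ofNat, Real.sqrt_eq_rpow,
      ← ENNReal.ofReal_rpow_of_nonneg hδ (by norm_num), hcδ]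

theorem isCompact_setOf_isQuantumState : IsCompact {σ : HE →L[ℂ] HE | IsQuantumState σ} := by
  have : ProperSpace (HE →L[ℂ] HE) := FiniteDimensional.proper ℂ _
  refine Metric.isCompact_of_isClosed_isBounded ?_ ?_
  · refine CStarAlgebra.isClosed_nonneg.inter (isClosed_eq ?_ continuous_const)
    exact LinearMap.continuous_of_finiteDimensional
      (LinearMap.trace ℂ HE ∘ₗ ContinuousLinearMap.coeLM ℂ)
  · refine (Metric.isBounded_closedBall (x := 0) (r := 1)).subset fun σ hσ => ?_
    obtain ⟨m, s, rfl, hs⟩ := isQuantumState_iff_exists.1 hσ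
    rw [mem_closedBall_zero_iff, ← hs]
    refine (norm_sum_le _ _).trans (Finset.sum_le_sum fun i _ => ?_)
    rw [InnerProductSpace.norm_rankOne, sq]

theorem lowerSemicontinuous_cbNorm_sub_depolarizingChannel (Φ : (HE →L[ℂ] HE) →ₗ[ℂ] (HA →L[ℂ] HA)) :
    LowerSemicontinuous fun σ : HE →L[ℂ] HE => cbNorm (Φ - depolarizingChannel HA σ) := by
  unfold cbNorm
  refine lowerSemicontinuous_iSup fun n => lowerSemicontinuous_iSup fun X =>
    lowerSemicontinuous_iSup fun hX => Continuous.lowerSemicontinuous ?_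
  refine ENNReal.continuous_ofReal.comp (continuous_norm.comp ?_)
  let L : (HE →L[ℂ] HE) →ₗ[ℂ] CStarMatrix (Fin n) (Fin n) (HA →L[ℂ] HA) :=
    { toFun := fun σ => X.map (depolarizingChannel HA σ)
      map_add' := fun σ τ => CStarMatrix.ext fun i j => by
        simp [depolarizingChannel, add_mul, add_smul]
      map_smul' := fun c σ => CStarMatrix.ext fun i j => by
        simp [depolarizingChannel, mul_smul] }
  exact (continuous_const (y := X.map Φ)).sub L.continuous_of_finiteDimensional

end Tradeoff

theorem theorem2 {HA HB HE : Type*}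
    [NormedAddCommGroup HA] [InnerProductSpace ℂ HA] [FiniteDimensional ℂ HA] [Nontrivial HA]
    [NormedAddCommGroup HB] [InnerProductSpace ℂ HB] [FiniteDimensional ℂ HB]
    [NormedAddCommGroup HE] [InnerProductSpace ℂ HE] [FiniteDimensional ℂ HE]
    (TB : QuantumChannel HB HA) (V : HA →L[ℂ] HB ⊗[ℂ] HE)
    (hV : IsStinespringRepresentation TB V) :
    (∀ σ : HE →L[ℂ] HE, IsQuantumState σ →
      (1 / 4) * decodingError TB ^ 2 ≤
        cbNorm (complementaryChannel V - depolarizingChannel HA σ)) ∧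
    ∃ σ : HE →L[ℂ] HE, IsQuantumState σ ∧
      cbNorm (complementaryChannel V - depolarizingChannel HA σ) ≤
        2 * decodingError TB ^ (1 / 2 : ℝ) := by
  refine ⟨fun σ hσ => ?_, ?_⟩
  · rcases eq_or_ne (cbNorm (complementaryChannel V - depolarizingChannel HA σ)) ⊤ with htop | htop
    · rw [htop]
      exact le_top
    · set c := cbNorm (complementaryChannel V - depolarizingChannel HA σ) with hc
      have hcδ : ENNReal.ofReal c.toReal = c := ENNReal.ofReal_toReal htop
      have h := decodingError_le_of_cbNorm_le hV hσ ENNReal.toReal_nonneg hcδ.symm.le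
      calc (1 / 4 : ℝ≥0∞) * decodingError TB ^ 2
          ≤ 1 / 4 * ENNReal.ofReal (2 * √c.toReal) ^ 2 := by gcongr
        _ = c := by
          have h4 : (1 / 4 : ℝ≥0∞) = ENNReal.ofReal (1 / 4) := by
            rw [ENNReal.ofReal_div_of_pos (by norm_num)]
            simp
          rw [← ENNReal.ofReal_pow (by positivity), h4, ← ENNReal.ofReal_mul (by norm_num), mul_pow,
            Real.sq_sqrt ENNReal.toReal_nonneg, ← mul_assoc]
          rw [show (1 / 4 * 2 ^ 2 : ℝ) = 1 by norm_num, one_mul, hcδ]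
  · obtain ⟨m, R, hR⟩ := exists_extend_isKrausIsometry (W := fun _ : Fin 0 => (0 : HB →L[ℂ] HA))
      ⟨zero_le_one, fun x => by simp⟩
    -- the channel only serves to see that there are states at all
    obtain ⟨σ₀, hσ₀, -⟩ := exists_isQuantumState_cbNorm_le hV
      (krausChannel (Sum.elim (fun _ => 0) R) (krausMap_one_eq_one_iff.2 hR))
    obtain ⟨σ, hσ, hmin⟩ := LowerSemicontinuousOn.exists_isMinOn ⟨σ₀, hσ₀⟩
      isCompact_setOf_isQuantumState
      ((lowerSemicontinuous_cbNorm_sub_depolarizingChannel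
        (complementaryChannel V)).lowerSemicontinuousOn _)
    refine ⟨σ, hσ, ?_⟩
    have hpow : decodingError TB ^ (1 / 2 : ℝ) = ⨅ D : QuantumChannel HA HB,
        cbNorm (TB.toLinearMap ∘ₗ D.toLinearMap - LinearMap.id) ^ (1 / 2 : ℝ) :=
      (ENNReal.orderIsoRpow (1 / 2) (by norm_num)).map_iInf _
    rw [hpow, ENNReal.mul_iInf_of_ne two_ne_zero ENNReal.ofNat_ne_top]
    refine le_iInf fun D => ?_
    obtain ⟨τ, hτ, hle⟩ := exists_isQuantumState_cbNorm_le hV D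
    exact (hmin hτ).trans hle

end
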